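/- Fix $2<L<\infty$ and $\mu\in\mathbb R$, and let $\Phi:\mathbb R\to\mathbb R$ be a potential with $\Phi'(r)=\Psi(r)e^{r}$ for $r\ge 0$ (one-sided derivative at $0$; the values of $\Phi$ and $\Psi$ on $(-\infty,0)$ play no role), where $\Psi:[0,\infty)\to[0,\infty)$ is continuously differentiable with $\Psi(0)=0$, $\Psi(r)>0$ and $\Psi'(r)+\Psi(r)\ge 0$ for all $r>0$, and $\left|\Psi(r)r^{-\mu}-1\right|\le C_\Psi/r$ for all $r\ge 1$ with some constant $C_\Psi>0$. Denote by $\|\cdot\|_p$ the $L^p$-norm on the periodicity cell $[-L,L]$, put $$(\mathcal A V)(x):=\int_{x-1/2}^{x+1/2}V(\tilde x)\,d\tilde x ,\qquad \mathcal P_\delta(V):=\int_{-L}^{L}\Phi\left(\frac{(\mathcal A V)(x)}{\delta}\right)dx ,$$ and let $\mathcal C$ be the cone of all $V$ with $V(-x)=V(x)\ge V(\tilde x)\ge 0$ for almost all $0\le x\le\tilde x\le L$. For $\delta>0$, a *maximizer* is a $2L$-periodic function $V_\delta\in\mathcal C$, square integrable on $[-L,L]$, with $\|V_\delta\|_2=1$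 that maximizes $\mathcal P_\delta$ among all such functions; put $R_\delta:=\mathcal A V_\delta$. Let $$\overline V_\delta(x):=\frac{(1+\delta)\sinh\left(\frac1{2\delta}\right)}{\cosh\left(\frac1{2\delta}\right)+\cosh\left(\frac{x}{\delta}\right)},\qquad \overline R_\delta(x):=(\delta+\delta^2)\ln\left(1+\frac{\sinh^2\left(\frac1{2\delta}\right)}{\cosh^2\left(\frac{x}{2\delta}\right)}\right).$$ Then there exist constants $C>0$ and $\delta_0>0$, depending only on $L$, $\mu$ and $\Psi$, such that for all $0<\delta<\delta_0$, every maximizer $V_\delta$ and all $1\le p\le\infty$ $$\|V_\delta-\overline V_\delta\|_p\le C\,\delta^{1+1/p},\qquad \|R_\delta-\overline R_\delta\|_p\le C\,\delta^{2},$$ where $1/p:=0$ for $p=\infty$. -/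

import Mathlib

open MeasureTheory Set
open scoped ENNReal

namespace FPU

noncomputable section

/-- `Φ` is a potential on `[0, ∞)` with derivative `Φ'(r) = Ψ(r) exp(r)`. -/
def IsPotential (Φ Ψ : ℝ → ℝ) : Prop :=
  ∀ r : ℝ, 0 ≤ r → HasDerivWithinAt Φ (Ψ r * Real.exp r) (Ici 0) r

/-- Standing assumption on the factor `Ψ` of the force `Ψ(r) exp(r)`: it is `C¹` on `[0, ∞)`,
vanishes at `0`, is positive on `(0, ∞)`, satisfies `Ψ' + Ψ ≥ 0` (that is, the force is
nondecreasing) and grows like `r ^ μ`. -/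
structure IsForce (Ψ : ℝ → ℝ) (μ : ℝ) : Prop where
  contDiffOn : ContDiffOn ℝ 1 Ψ (Ici 0)
  zero : Ψ 0 = 0
  pos : ∀ r : ℝ, 0 < r → 0 < Ψ r
  mono : ∀ r : ℝ, 0 < r → 0 ≤ deriv Ψ r + Ψ r
  growth : ∃ C : ℝ, 0 < C ∧ ∀ r : ℝ, 1 ≤ r → |Ψ r / r ^ μ - 1| ≤ C / r

/-- Lebesgue measure on the periodicity cell `[-L, L]`. -/
def cell (L : ℝ) : Measure ℝ := volume.restrict (Icc (-L) L)

/-- The operator `(𝒜 V)(x) = ∫_{x - 1/2}^{x + 1/2} V`. -/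
def avg (V : ℝ → ℝ) (x : ℝ) : ℝ := ∫ t in (x - 1 / 2)..(x + 1 / 2), V t

/-- The potential energy `∫_{-L}^{L} Φ((𝒜 V)(x) / δ) dx`. -/
def energy (Φ : ℝ → ℝ) (L δ : ℝ) (V : ℝ → ℝ) : ℝ := ∫ x in (-L)..L, Φ (avg V x / δ)

/-- The cone of functions that are even, nonnegative and unimodal on `[-L, L]`, up to a null set:
`V(-x) = V(x) ≥ V(y) ≥ 0` for almost all `0 ≤ x ≤ y ≤ L`. -/
def cone (L : ℝ) : Set (ℝ → ℝ) :=
  {V | ∃ N : Set ℝ, volume N = 0 ∧ ∀ x y : ℝ, x ∉ N → y ∉ N → 0 ≤ x → x ≤ y → y ≤ L →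
    V (-x) = V x ∧ V y ≤ V x ∧ 0 ≤ V y}

/-- The admissible profiles: `2L`-periodic, square integrable on the cell, in the cone, and
with `L²`-norm `1` on the cell. -/
def admissible (L : ℝ) : Set (ℝ → ℝ) :=
  {V | Function.Periodic V (2 * L) ∧ MemLp V 2 (cell L) ∧ eLpNorm V 2 (cell L) = 1 ∧ V ∈ cone L}

/-- `V` solves the constrained optimization problem with parameter `δ`. -/
def IsMaximizer (Φ : ℝ → ℝ) (L δ : ℝ) (V : ℝ → ℝ) : Prop :=
  V ∈ admissible L ∧ ∀ U ∈ admissible L, energy Φ L δ U ≤ energy Φ L δ V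

/-- The explicit approximate velocity profile. -/
def approxV (δ x : ℝ) : ℝ :=
  (1 + δ) * Real.sinh (1 / (2 * δ)) / (Real.cosh (1 / (2 * δ)) + Real.cosh (x / δ))

/-- The explicit approximate distance profile. -/
def approxR (δ x : ℝ) : ℝ :=
  (δ + δ ^ 2) * Real.log (1 + Real.sinh (1 / (2 * δ)) ^ 2 / Real.cosh (x / (2 * δ)) ^ 2)

end

end FPU

/-! Write `F(r) = Ψ(r) eʳ` for the force, `R = 𝒜 V` and `𝒫` for the energy. Three observations give
the asymptotics.

*Euler–Lagrange equation and concentration.* The gradient `𝒜 F(R / δ)` of the energy belongs to the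
cone, and `Φ` is convex, so a maximizer equals its own normalized gradient: `V = 𝒜 G` with
`G = F(R / δ) / σ` (`IsMaximizer.exists_euler_lagrange`). Comparing the energy of a maximizer with
that of the indicator function `χ` of `[-1/2, 1/2]` gives `R(0) ≈ 1`
(`IsForce.exists_lt_avg_zero`); since `R(0)` is the inner product of the unit vectors `V` and `χ`,
`V` is `L²`-close to `χ` and `R` is close to the tent `1 - |x|`. As `F` grows exponentially, `G` is
then exponentially small away from the origin.

*A logistic equation.* Let `K(x) = ∫₀ˣ G` and `m = 2 K(L)`. Then `V(x) = K(x + 1/2) - K(x - 1/2)`,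
and near the origin `R' ≈ -2 K`. With `E = exp(R / δ)` one has `K' = G ≈ A E` for a constant `A`, so
`K² + δ A E` is almost conserved (`IsForce.exists_first_integral_approx`). Its value is `≈ (m/2)²`,
which gives `δ K' ≈ (m/2)² - K²` with a relative error `O(δ + |x|)` (`IsForce.exists_logistic`).
Only the values of `Ψ` enter: the growth condition controls `Ψ` but not `Ψ'`, and this is why `E`
rather than `G` is differentiated. Integrating, `K` is `m (sigmoid - 1/2)` of a phase close to
`m x / δ` (`IsForce.exists_phase`).

*The mass.* Up to exponentially small terms, `1 = ‖V‖₂² = m² - 4 ∫₀^{1/2} ((m/2)² - K²)`, and by the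
logistic equation the integral is `δ m / 2 + O(δ²)`. Hence `(m - δ)² = 1 + O(δ²)` and
`m = 1 + δ + O(δ²)` (`IsForce.exists_mass_approx`).

Together, `K` differs from `(1 + δ) (sigmoid(x / δ) - 1/2)` by `O(δ²)` plus a term of size `δ`
decaying exponentially in `|x| / δ` (`IsForce.exists_abs_prim_sub_kink_le`). The explicit velocity
profile is a difference of shifts of this kink and the explicit distance profile is its average, so
the velocity error is `O(δ)` uniformly and `O(δ²)` in `L¹`; interpolation yields all `Lᵖ` norms, and
averaging the `L¹` estimate bounds the distance error uniformly. -/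

namespace FPU

/-! ### Bell-shaped profiles and the averaging operator -/

/-- Continuous functions with the shape that the cone prescribes almost everywhere: `2L`-periodic,
even, nonnegative and nonincreasing on `[0, L]`. -/
structure IsBell (L : ℝ) (f : ℝ → ℝ) : Prop where
  cont : Continuous f
  periodic : Function.Periodic f (2 * L)
  even : ∀ x, f (-x) = f x
  anti : AntitoneOn f (Icc 0 L)
  nonneg : ∀ x, 0 ≤ f x

theorem avg_eq_integral_add (V : ℝ → ℝ) (x : ℝ) :
    avg V x = ∫ s in (-(1 / 2 : ℝ))..(1 / 2), V (x + s) := by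
  rw [intervalIntegral.integral_comp_add_left (fun t => V t), avg]
  congr 1

theorem avg_sub (V : ℝ → ℝ) (hV : ∀ a b, IntervalIntegrable V volume a b) (x c : ℝ) :
    avg V x = (∫ t in c..(x + 1 / 2), V t) - ∫ t in c..(x - 1 / 2), V t := by
  rw [avg, intervalIntegral.integral_interval_sub_left (hV _ _) (hV _ _)]

theorem avg_continuous {V : ℝ → ℝ} (hV : ∀ a b, IntervalIntegrable V volume a b) :
    Continuous (avg V) := by
  have h := intervalIntegral.continuous_primitive hV 0
  have : avg V = fun x => (∫ t in (0 : ℝ)..(x + 1 / 2), V t) - ∫ t in (0 : ℝ)..(x - 1 / 2), V t :=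
    funext fun x => avg_sub V hV x 0
  rw [this]
  exact (h.comp (by fun_prop : Continuous fun x : ℝ => x + 1 / 2)).sub
    (h.comp (by fun_prop : Continuous fun x : ℝ => x - 1 / 2))

theorem avg_periodic {V : ℝ → ℝ} {T : ℝ} (hV : Function.Periodic V T) :
    Function.Periodic (avg V) T := by
  intro x
  rw [avg_eq_integral_add, avg_eq_integral_add]
  congr 1; ext s
  rw [show x + T + s = x + s + T by ring, hV]

theorem avg_congr_ae {V W : ℝ → ℝ} (h : V =ᵐ[volume] W) : avg V = avg W := by
  ext x
  exact intervalIntegral.integral_congr_ae (h.mono fun t ht _ => ht)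

theorem ae_notMem_comp {N : Set ℝ} (hN : volume N = 0) {φ : ℝ → ℝ}
    (hφ : MeasurePreserving φ volume volume) : ∀ᵐ t, φ t ∉ N :=
  hφ.quasiMeasurePreserving.ae (measure_eq_zero_iff_ae_notMem.1 hN)

theorem measurePreserving_add_const (c : ℝ) :
    MeasurePreserving (fun t : ℝ => t + c) volume volume := measurePreserving_add_right volume c

theorem measurePreserving_const_sub (c : ℝ) :
    MeasurePreserving (fun t : ℝ => c - t) volume volume :=
  Measure.measurePreserving_sub_left volume c

theorem exists_abs_sub_le {L : ℝ} (hL : 0 < L) (t : ℝ) : ∃ n : ℤ, |t - n * (2 * L)| ≤ L := by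
  refine ⟨round (t / (2 * L)), ?_⟩
  have h := abs_sub_round (t / (2 * L))
  have e : t - round (t / (2 * L)) * (2 * L) = (t / (2 * L) - round (t / (2 * L))) * (2 * L) := by
    field_simp
  rw [e, abs_mul, abs_of_pos (by positivity : 0 < 2 * L)]
  nlinarith

/-- By periodicity the symmetry and sign conditions of the cone hold almost everywhere on the whole
line. -/
theorem ae_even_nonneg_of_mem_cone {L : ℝ} {V : ℝ → ℝ} (hV : V ∈ cone L)
    (hp : Function.Periodic V (2 * L)) (hL : 0 < L) : ∀ᵐ t, V (-t) = V t ∧ 0 ≤ V t := by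
  obtain ⟨N, hN, h⟩ := hV
  have h1 : ∀ᵐ t : ℝ, ∀ n : ℤ, t + (-(n * (2 * L))) ∉ N :=
    ae_all_iff.2 fun n => ae_notMem_comp hN (measurePreserving_add_const _)
  have h2 : ∀ᵐ t : ℝ, ∀ n : ℤ, n * (2 * L) - t ∉ N :=
    ae_all_iff.2 fun n => ae_notMem_comp hN (measurePreserving_const_sub _)
  filter_upwards [h1, h2] with t h1 h2
  obtain ⟨n, hn⟩ := exists_abs_sub_le hL t
  have e1 : V (t + (-(n * (2 * L)))) = V t := by
    rw [← sub_eq_add_neg]; exact hp.sub_int_mul_eq n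
  have e2 : V (n * (2 * L) - t) = V (-t) := by
    rw [show (n : ℝ) * (2 * L) - t = -t + n * (2 * L) by ring]; exact hp.int_mul n (-t)
  have e3 : n * (2 * L) - t = -(t + (-(n * (2 * L)))) := by ring
  rw [abs_le] at hn
  rcases le_total 0 (t + (-(n * (2 * L)))) with h0 | h0
  · have := h _ _ (h1 n) (h1 n) h0 le_rfl (by linarith)
    rw [← e3, e1, e2] at this
    exact ⟨this.1, this.2.2⟩
  · have := h _ _ (h2 n) (h2 n) (by linarith) le_rfl (by linarith)
    rw [e3, neg_neg, ← e3, e1, e2] at this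
    exact ⟨this.1.symm, this.1 ▸ this.2.2⟩

/-- This is `(𝒜 V)' ≤ 0` on `[0, L]`: modulo `2L`, the point `t + 1/2` is farther from `0` than
`t - 1/2`. -/
theorem ae_unit_shift_le_of_mem_cone {L : ℝ} {V : ℝ → ℝ} (hV : V ∈ cone L)
    (hp : Function.Periodic V (2 * L)) (hL : 2 < L) :
    ∀ᵐ t, t ∈ Icc 0 L → V (t + 1 / 2) ≤ V (t - 1 / 2) := by
  obtain ⟨N, hN, h⟩ := hV
  filter_upwards [ae_notMem_comp hN (measurePreserving_add_const (1 / 2)),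
    ae_notMem_comp hN (measurePreserving_add_const (-(1 / 2))),
    ae_notMem_comp hN (measurePreserving_const_sub (1 / 2)),
    ae_notMem_comp hN (measurePreserving_const_sub (2 * L - 1 / 2))] with t h1 h2 h3 h4 ht
  obtain ⟨ht0, htL⟩ := ht
  rw [← sub_eq_add_neg] at h2
  rcases le_total t (1 / 2) with h5 | h5
  · have := h _ _ h3 h1 (by linarith) (by linarith) (by linarith)
    rw [neg_sub] at this
    linarith [this.1, this.2.1]
  rcases le_total (t + 1 / 2) L with h6 | h6
  · exact (h _ _ h2 h1 (by linarith) (by linarith) h6).2.1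
  · have a := (h _ _ h2 h4 (by linarith) (by linarith) (by linarith)).2.1
    have b := (h _ _ h4 h4 (by linarith) le_rfl (by linarith)).1
    have c := hp (-(2 * L - 1 / 2 - t))
    rw [show -(2 * L - 1 / 2 - t) + 2 * L = t + 1 / 2 by ring] at c
    linarith

theorem isBell_avg {L : ℝ} (hL : 2 < L) {V : ℝ → ℝ} (hp : Function.Periodic V (2 * L))
    (hi : ∀ a b, IntervalIntegrable V volume a b) (hV : V ∈ cone L) : IsBell L (avg V) where
  cont := avg_continuous hi
  periodic := avg_periodic hp
  even x := by
    rw [avg, avg, show -x - 1 / 2 = -(x + 1 / 2) by ring, show -x + 1 / 2 = -(x - 1 / 2) by ring,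
      ← intervalIntegral.integral_comp_neg]
    exact intervalIntegral.integral_congr_ae
      ((ae_even_nonneg_of_mem_cone hV hp (by linarith)).mono fun t ht _ => ht.1)
  anti := by
    intro x hx y hy hxy
    have e : avg V y - avg V x = ∫ t in x..y, (V (t + 1 / 2) - V (t - 1 / 2)) := by
      rw [intervalIntegral.integral_sub, intervalIntegral.integral_comp_add_right,
        intervalIntegral.integral_comp_sub_right, avg_sub V hi y 0, avg_sub V hi x 0,
        ← intervalIntegral.integral_interval_sub_left (hi 0 (y + 1 / 2)) (hi 0 (x + 1 / 2)),
        ← intervalIntegral.integral_interval_sub_left (hi 0 (y - 1 / 2)) (hi 0 (x - 1 / 2))]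
      · ring
      · simpa using (hi (x + 1 / 2) (y + 1 / 2)).comp_add_right (1 / 2)
      · simpa using (hi (x - 1 / 2) (y - 1 / 2)).comp_sub_right (1 / 2)
    have : ∫ t in x..y, (V (t + 1 / 2) - V (t - 1 / 2)) ≤ 0 := by
      rw [intervalIntegral.integral_of_le hxy]
      refine setIntegral_nonpos_ae measurableSet_Ioc ?_
      filter_upwards [ae_unit_shift_le_of_mem_cone hV hp hL] with t ht h
      linarith [ht ⟨hx.1.trans h.1.le, h.2.trans hy.2⟩]
    linarith
  nonneg x := intervalIntegral.integral_nonneg_of_ae (by linarith)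
    ((ae_even_nonneg_of_mem_cone hV hp (by linarith)).mono fun t ht => ht.2)

theorem IsBell.mem_cone {L : ℝ} {f : ℝ → ℝ} (hf : IsBell L f) : f ∈ cone L :=
  ⟨∅, by simp, fun x y _ _ h0 hxy hy =>
    ⟨hf.even x, hf.anti ⟨h0, hxy.trans hy⟩ ⟨h0.trans hxy, hy⟩ hxy, hf.nonneg y⟩⟩

theorem IsBell.bell_avg {L : ℝ} (hL : 2 < L) {f : ℝ → ℝ} (hf : IsBell L f) : IsBell L (avg f) :=
  isBell_avg hL hf.periodic (fun a b => hf.cont.intervalIntegrable a b) hf.mem_cone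

theorem IsBell.comp {L : ℝ} {f g : ℝ → ℝ} (hf : IsBell L f) (hg : ContinuousOn g (Ici 0))
    (hm : MonotoneOn g (Ici 0)) (h0 : ∀ r, 0 ≤ r → 0 ≤ g r) : IsBell L (fun x => g (f x)) where
  cont := hg.comp_continuous hf.cont hf.nonneg
  periodic x := by simp only [hf.periodic x]
  even x := by simp only [hf.even x]
  anti x hx y hy hxy := hm (hf.nonneg _) (hf.nonneg _) (hf.anti hx hy hxy)
  nonneg x := h0 _ (hf.nonneg x)

theorem admissible.intervalIntegrable {L : ℝ} (hL : 2 < L) {V : ℝ → ℝ} (hV : V ∈ admissible L) :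
    ∀ a b, IntervalIntegrable V volume a b := by
  obtain ⟨hp, h2, -, -⟩ := hV
  have : IsFiniteMeasure (cell L) := by unfold cell; infer_instance
  have h1 : Integrable V (cell L) :=
    (h2.mono_exponent (by norm_num : (1 : ℝ≥0∞) ≤ 2)).integrable le_rfl
  refine hp.intervalIntegrable (by linarith) (t := -L) ?_
  rw [show -L + 2 * L = L by ring, intervalIntegrable_iff_integrableOn_Icc_of_le (by linarith)]
  exact h1

/-- The averaging operator is symmetric on periodic functions. -/
theorem integral_mul_avg {T a : ℝ} (hT : 0 < T) {f V : ℝ → ℝ} (hf : Continuous f)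
    (hfp : Function.Periodic f T) (hp : Function.Periodic V T)
    (hi : ∀ a b, IntervalIntegrable V volume a b) :
    ∫ x in a..(a + T), f x * avg V x = ∫ x in a..(a + T), avg f x * V x := by
  obtain ⟨M, hM⟩ : ∃ M, ∀ x, ‖f x‖ ≤ M := by
    obtain ⟨M, hM⟩ := (isCompact_Icc (a := 0) (b := T)).exists_bound_of_continuousOn hf.continuousOn
    refine ⟨M, fun x => ?_⟩
    obtain ⟨y, hy, e⟩ := hfp.exists_mem_Ico₀ hT x
    rw [e]
    exact hM y ⟨hy.1, hy.2.le⟩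
  have hprod : ∀ c d : ℝ, IntegrableOn (fun z : ℝ × ℝ => V z.2)
      (uIoc (-(1 / 2)) (1 / 2) ×ˢ uIoc c d) := by
    intro c d
    rw [IntegrableOn, Measure.volume_eq_prod, ← Measure.prod_restrict]
    have h1 : IntegrableOn V (uIoc c d) := intervalIntegrable_iff.1 (hi _ _)
    have : IsFiniteMeasure (volume.restrict (uIoc (-(1 / 2 : ℝ)) (1 / 2))) := by
      unfold uIoc; infer_instance
    exact Integrable.comp_snd h1 _
  have hshift : IntegrableOn (fun z : ℝ × ℝ => V (z.1 + z.2))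
      (uIoc (-(1 / 2)) (1 / 2) ×ˢ uIoc a (a + T)) := by
    have h1 := ((measurePreserving_prod_add (volume : Measure ℝ) (volume : Measure ℝ)
      ).integrableOn_comp_preimage (MeasurableEquiv.shearAddRight ℝ).measurableEmbedding).2
      (hprod (a - 1) (a + T + 1))
    refine h1.mono_set ?_
    rintro ⟨s, x⟩ ⟨hs, hx⟩
    rw [uIoc_of_le (by norm_num)] at hs
    rw [uIoc_of_le (by linarith)] at hx
    have hs1 := hs.1
    have hs2 := hs.2
    have hx1 := hx.1
    have hx2 := hx.2
    simp only at hs1 hs2 hx1 hx2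
    refine ⟨?_, ?_⟩
    · rw [uIoc_of_le (by norm_num)]; exact hs
    · rw [uIoc_of_le (by linarith)]; constructor <;> simp only <;> linarith
  calc ∫ x in a..(a + T), f x * avg V x
      = ∫ x in a..(a + T), ∫ s in (-(1 / 2 : ℝ))..(1 / 2), f x * V (x + s) := by
        congr 1; ext x
        rw [avg_eq_integral_add, intervalIntegral.integral_const_mul]
    _ = ∫ s in (-(1 / 2 : ℝ))..(1 / 2), ∫ x in a..(a + T), f x * V (x + s) := by
        refine (intervalIntegral_intervalIntegral_swap ?_).symm
        have : IntegrableOn (fun z : ℝ × ℝ => f z.2 * V (z.1 + z.2))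
            (uIoc (-(1 / 2)) (1 / 2) ×ˢ uIoc a (a + T)) :=
          Integrable.bdd_mul hshift (c := M) (by fun_prop)
            (Filter.Eventually.of_forall fun z => hM _)
        refine this.congr_fun (fun z _ => ?_) (by measurability)
        simp only [Function.uncurry_def, add_comm z.1]
    _ = ∫ s in (-(1 / 2 : ℝ))..(1 / 2), ∫ x in a..(a + T), f (x - s) * V x := by
        congr 1; ext s
        have hper : Function.Periodic (fun x => f (x - s) * V x) T := by
          intro x
          simp only
          rw [hp, show x + T - s = x - s + T by ring, hfp]
        have := hper.intervalIntegral_add_eq a (a + s)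
        rw [this, show a + s + T = a + T + s by ring,
          ← intervalIntegral.integral_comp_add_right (fun x => f (x - s) * V x) s]
        simp
    _ = ∫ x in a..(a + T), ∫ s in (-(1 / 2 : ℝ))..(1 / 2), f (x - s) * V x := by
        refine intervalIntegral_intervalIntegral_swap ?_
        exact Integrable.bdd_mul (hprod a (a + T)) (c := M)
          (by fun_prop) (Filter.Eventually.of_forall fun z => hM _)
    _ = ∫ x in a..(a + T), avg f x * V x := by
        congr 1; ext x
        have := intervalIntegral.integral_comp_neg (a := -(1 / 2 : ℝ)) (b := 1 / 2)
          (fun s => f (x - s))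
        simp only [sub_neg_eq_add, neg_neg] at this
        rw [avg_eq_integral_add, intervalIntegral.integral_mul_const, this]

/-! ### The force and the potential -/

/-- The force `Φ'(r) = Ψ(r) eʳ`. -/
noncomputable def force (Ψ : ℝ → ℝ) (r : ℝ) : ℝ := Ψ r * Real.exp r

theorem IsForce.continuousOn_force {Ψ : ℝ → ℝ} {μ : ℝ} (hΨ : IsForce Ψ μ) :
    ContinuousOn (force Ψ) (Ici 0) :=
  hΨ.contDiffOn.continuousOn.mul Real.continuous_exp.continuousOn

theorem IsForce.monotoneOn_force {Ψ : ℝ → ℝ} {μ : ℝ} (hΨ : IsForce Ψ μ) :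
    MonotoneOn (force Ψ) (Ici 0) := by
  have hd : ∀ r ∈ interior (Ici (0 : ℝ)), HasDerivAt (force Ψ)
      (deriv Ψ r * Real.exp r + Ψ r * Real.exp r) r := by
    intro r hr
    rw [interior_Ici] at hr
    have h1 : DifferentiableAt ℝ Ψ r :=
      (hΨ.contDiffOn.differentiableOn (by norm_num)).differentiableAt (Ici_mem_nhds hr)
    exact h1.hasDerivAt.mul (Real.hasDerivAt_exp r)
  refine monotoneOn_of_deriv_nonneg (convex_Ici 0) hΨ.continuousOn_force
    (fun r hr => (hd r hr).differentiableAt.differentiableWithinAt) fun r hr => ?_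
  rw [(hd r hr).deriv, ← add_mul]
  rw [interior_Ici] at hr
  exact mul_nonneg (hΨ.mono r hr) (Real.exp_pos r).le

theorem IsForce.force_pos {Ψ : ℝ → ℝ} {μ : ℝ} (hΨ : IsForce Ψ μ) {r : ℝ} (hr : 0 < r) :
    0 < force Ψ r := mul_pos (hΨ.pos r hr) (Real.exp_pos r)

theorem IsForce.force_nonneg {Ψ : ℝ → ℝ} {μ : ℝ} (hΨ : IsForce Ψ μ) {r : ℝ} (hr : 0 ≤ r) :
    0 ≤ force Ψ r := by
  rcases hr.eq_or_lt with rfl | h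
  · simp [force, hΨ.zero]
  · exact (hΨ.force_pos h).le

theorem exp_neg_div_le {c δ : ℝ} (hc : 0 < c) (hδ : 0 < δ) (n : ℕ) :
    Real.exp (-(c / δ)) ≤ n.factorial / c ^ n * δ ^ n := by
  have h := Real.pow_div_factorial_le_exp (c / δ) (by positivity) n
  rw [Real.exp_neg, inv_le_comm₀ (Real.exp_pos _) (by positivity)]
  refine le_trans (le_of_eq ?_) h
  rw [div_pow]
  field_simp

/-- Exponentially small quantities are eventually below every power. -/
theorem exists_exp_neg_div_le {c : ℝ} (hc : 0 < c) (A : ℝ) (n : ℕ) :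
    ∃ δ₀ : ℝ, 0 < δ₀ ∧ ∀ δ, 0 < δ → δ < δ₀ → A * Real.exp (-(c / δ)) ≤ δ ^ n := by
  set B := (|A| + 1) * ((n + 1).factorial / c ^ (n + 1)) with hB
  have hB0 : 0 < B := by positivity
  refine ⟨1 / B, by positivity, fun δ hδ hlt => ?_⟩
  calc A * Real.exp (-(c / δ)) ≤ (|A| + 1) * Real.exp (-(c / δ)) := by
        gcongr; linarith [le_abs_self A]
    _ ≤ (|A| + 1) * ((n + 1).factorial / c ^ (n + 1) * δ ^ (n + 1)) := by
        gcongr; exact exp_neg_div_le hc hδ _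
    _ = (B * δ) * δ ^ n := by rw [hB, pow_succ δ n]; ring
    _ ≤ 1 * δ ^ n := by
        gcongr
        rw [lt_div_iff₀ hB0] at hlt
        linarith
    _ = δ ^ n := one_mul _

theorem IsForce.bounds_rpow {Ψ : ℝ → ℝ} {μ : ℝ} (hΨ : IsForce Ψ μ) :
    ∃ C : ℝ, 0 < C ∧ ∀ r, 1 ≤ r → |Ψ r - r ^ μ| ≤ C / r * r ^ μ := by
  obtain ⟨C, hC, h⟩ := hΨ.growth
  refine ⟨C, hC, fun r hr => ?_⟩
  have hp : 0 < r ^ μ := Real.rpow_pos_of_pos (by linarith) μ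
  have := h r hr
  have e : Ψ r - r ^ μ = (Ψ r / r ^ μ - 1) * r ^ μ := by field_simp
  rw [e, abs_mul, abs_of_pos hp]
  gcongr

/-- The exponential growth of the force separates two levels `a / δ < b / δ` by an arbitrary power
of `δ`. -/
theorem IsForce.exists_force_le {Ψ : ℝ → ℝ} {μ : ℝ} (hΨ : IsForce Ψ μ) {a b : ℝ} (ha : 0 < a)
    (hab : a < b) (n : ℕ) :
    ∃ δ₀ : ℝ, 0 < δ₀ ∧ ∀ δ, 0 < δ → δ < δ₀ →
      force Ψ (a / δ) ≤ δ ^ n * force Ψ (b / δ) := by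
  obtain ⟨C, hC, h⟩ := hΨ.bounds_rpow
  have hb : 0 < b := ha.trans hab
  have hp : 0 < (a / b) ^ μ := Real.rpow_pos_of_pos (by positivity) μ
  obtain ⟨δ₁, h₁, hδ₁⟩ := exists_exp_neg_div_le (sub_pos.2 hab) (3 * (a / b) ^ μ) n
  refine ⟨min δ₁ (min a (a / (2 * C))), by positivity, fun δ hδ hlt => ?_⟩
  have l1 : δ < δ₁ := hlt.trans_le (min_le_left _ _)
  have l2 : δ < a := hlt.trans_le ((min_le_right _ _).trans (min_le_left _ _))
  have l3 : δ < a / (2 * C) := hlt.trans_le ((min_le_right _ _).trans (min_le_right _ _))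
  have key : ∀ s, a ≤ s → |Ψ (s / δ) - (s / δ) ^ μ| ≤ 1 / 2 * (s / δ) ^ μ := by
    intro s hs
    have hs0 : 0 < s := ha.trans_le hs
    refine (h (s / δ) ((one_le_div hδ).2 (by linarith))).trans ?_
    have : 0 < (s / δ) ^ μ := Real.rpow_pos_of_pos (by positivity) μ
    refine mul_le_mul_of_nonneg_right ?_ this.le
    rw [lt_div_iff₀ (by positivity)] at l3
    rw [div_le_iff₀ (by positivity), mul_div_assoc', le_div_iff₀ hδ]
    linarith
  have ka := (abs_le.1 (key a le_rfl)).2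
  have kb := (abs_le.1 (key b hab.le)).1
  have e1 : (a / δ) ^ μ = (a / b) ^ μ * (b / δ) ^ μ := by
    rw [← Real.mul_rpow (by positivity) (by positivity)]
    congr 1; field_simp
  have e2 : Real.exp (a / δ) = Real.exp (-((b - a) / δ)) * Real.exp (b / δ) := by
    rw [← Real.exp_add]; congr 1; ring
  have hE := Real.exp_pos (b / δ)
  have hbp : 0 < (b / δ) ^ μ := Real.rpow_pos_of_pos (by positivity) μ
  calc force Ψ (a / δ) ≤ 3 / 2 * (a / δ) ^ μ * Real.exp (a / δ) := by
        unfold force; gcongr; linarith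
    _ = (3 * (a / b) ^ μ * Real.exp (-((b - a) / δ)))
          * (1 / 2 * (b / δ) ^ μ * Real.exp (b / δ)) := by
        rw [e1, e2]; ring
    _ ≤ δ ^ n * (1 / 2 * (b / δ) ^ μ * Real.exp (b / δ)) := by
        gcongr; exact hδ₁ δ hδ l1
    _ ≤ δ ^ n * force Ψ (b / δ) := by
        unfold force; gcongr; linarith

theorem exists_abs_rpow_sub_one_le (μ : ℝ) :
    ∃ C : ℝ, 0 < C ∧ ∀ t : ℝ, 1 / 2 ≤ t → t ≤ 1 → |t ^ μ - 1| ≤ C * (1 - t) := by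
  have hne : ∀ x ∈ Icc (1 / 2 : ℝ) 1, x ≠ 0 := fun x hx => by linarith [hx.1]
  have hd : ∀ x ∈ Icc (1 / 2 : ℝ) 1, HasDerivWithinAt (fun x : ℝ => x ^ μ) (μ * x ^ (μ - 1))
      (Icc (1 / 2) 1) x := fun x hx =>
    (Real.hasDerivAt_rpow_const (Or.inl (hne x hx))).hasDerivWithinAt
  have hc : ContinuousOn (fun x : ℝ => μ * x ^ (μ - 1)) (Icc (1 / 2) 1) :=
    continuousOn_const.mul
      (continuousOn_id.rpow_const fun x hx => Or.inl (hne x hx))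
  obtain ⟨M, hM⟩ := isCompact_Icc.exists_bound_of_continuousOn hc
  refine ⟨|M| + 1, by positivity, fun t h1 h2 => ?_⟩
  have := (convex_Icc (1 / 2 : ℝ) 1).norm_image_sub_le_of_norm_hasDerivWithin_le hd
    (fun x hx => (hM x hx).trans ((le_abs_self M).trans (by linarith : |M| ≤ |M| + 1)))
    (right_mem_Icc.2 (by norm_num)) (⟨h1, h2⟩ : t ∈ Icc (1 / 2 : ℝ) 1)
  simpa [abs_sub_comm t 1, abs_of_nonneg (sub_nonneg.2 h2)] using this

/-- For `R ≤ R₀` of order one, `Ψ(R / δ)` may be replaced by the constant `(R₀ / δ) ^ μ` up to a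
relative error of order `δ + (R₀ - R)`. -/
theorem IsForce.exists_abs_sub_rpow_le {Ψ : ℝ → ℝ} {μ : ℝ} (hΨ : IsForce Ψ μ) :
    ∃ C : ℝ, 0 < C ∧ ∀ δ R₀ R : ℝ, 0 < δ → δ ≤ 1 / 2 → 1 / 2 ≤ R → R ≤ R₀ → R₀ ≤ 1 →
      |Ψ (R / δ) - (R₀ / δ) ^ μ| ≤ C * (δ + (R₀ - R)) * (R₀ / δ) ^ μ := by
  obtain ⟨C, hC, h⟩ := hΨ.bounds_rpow
  obtain ⟨C', hC', h'⟩ := exists_abs_rpow_sub_one_le μ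
  refine ⟨2 * C * (1 + C') + 2 * C', by positivity, fun δ R₀ R hδ hδ2 hR hRR hR1 => ?_⟩
  set t := R / R₀ with ht
  have hR0 : 0 < R₀ := by linarith
  have ht1 : t ≤ 1 := (div_le_one hR0).2 hRR
  have ht2 : 1 / 2 ≤ t := by rw [ht, le_div_iff₀ hR0]; linarith
  have hpos : 0 < (R₀ / δ) ^ μ := Real.rpow_pos_of_pos (by positivity) μ
  have e : (R / δ) ^ μ = t ^ μ * (R₀ / δ) ^ μ := by
    rw [← Real.mul_rpow (by positivity) (by positivity)]
    congr 1; rw [ht]; field_simp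
  have h1 := h (R / δ) ((one_le_div hδ).2 (by linarith))
  have h2 := h' t ht2 ht1
  have h3 : C / (R / δ) ≤ 2 * C * δ := by
    rw [div_le_iff₀ (by apply div_pos <;> linarith)]
    have : 2 * C * δ * (R / δ) = 2 * C * R := by field_simp
    rw [this]; nlinarith
  have h4 : 1 - t ≤ 2 * (R₀ - R) := by
    have : 1 - t = (R₀ - R) / R₀ := by rw [ht]; field_simp
    rw [this, div_le_iff₀ hR0]; nlinarith
  have h5 : t ^ μ ≤ 1 + C' := by
    have := (abs_le.1 h2).2
    nlinarith
  have h6 : 0 ≤ t ^ μ := (Real.rpow_pos_of_pos (by linarith) μ).le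
  rw [e] at h1
  have e2 : Ψ (R / δ) - (R₀ / δ) ^ μ
      = (Ψ (R / δ) - t ^ μ * (R₀ / δ) ^ μ) + (t ^ μ - 1) * (R₀ / δ) ^ μ := by ring
  rw [e2]
  refine (abs_add_le _ _).trans ?_
  rw [abs_mul, abs_of_pos hpos]
  calc _ ≤ 2 * C * δ * ((1 + C') * (R₀ / δ) ^ μ) + C' * (2 * (R₀ - R)) * (R₀ / δ) ^ μ := by
        refine add_le_add (h1.trans ?_) ?_
        · gcongr
        · have := h2.trans (mul_le_mul_of_nonneg_left h4 hC'.le)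
          gcongr
    _ ≤ _ := by
        rw [← sub_nonneg]
        have : (2 * C * (1 + C') + 2 * C') * (δ + (R₀ - R)) * (R₀ / δ) ^ μ
          - (2 * C * δ * ((1 + C') * (R₀ / δ) ^ μ) + C' * (2 * (R₀ - R)) * (R₀ / δ) ^ μ)
          = (2 * C' * δ + 2 * C * (1 + C') * (R₀ - R)) * (R₀ / δ) ^ μ := by ring
        rw [this]
        have : 0 ≤ R₀ - R := by linarith
        positivity

/-- Convexity of the potential on `[0, ∞)`. -/
theorem IsPotential.force_mul_sub_le {Φ Ψ : ℝ → ℝ} {μ : ℝ} (hΦ : IsPotential Φ Ψ)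
    (hΨ : IsForce Ψ μ) {a b : ℝ} (ha : 0 ≤ a) (hb : 0 ≤ b) :
    force Ψ a * (b - a) ≤ Φ b - Φ a := by
  have hc : ContinuousOn Φ (Ici 0) := fun r hr => (hΦ r hr).continuousWithinAt
  have hd : ∀ r, 0 < r → HasDerivAt Φ (force Ψ r) r := fun r hr =>
    (hΦ r hr.le).hasDerivAt (Ici_mem_nhds hr)
  rcases lt_trichotomy a b with h | rfl | h
  · obtain ⟨c, hc1, hc2⟩ := exists_hasDerivAt_eq_slope Φ (force Ψ) h
      (hc.mono fun x hx => ha.trans hx.1) fun x hx => hd x (ha.trans_lt hx.1)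
    rw [eq_div_iff (by linarith)] at hc2
    rw [← hc2]
    have := hΨ.monotoneOn_force ha (ha.trans hc1.1.le : (0 : ℝ) ≤ c) hc1.1.le
    exact mul_le_mul_of_nonneg_right this (by linarith)
  · simp
  · obtain ⟨c, hc1, hc2⟩ := exists_hasDerivAt_eq_slope Φ (force Ψ) h
      (hc.mono fun x hx => hb.trans hx.1) fun x hx => hd x (hb.trans_lt hx.1)
    rw [eq_div_iff (by linarith)] at hc2
    have := hΨ.monotoneOn_force (hb.trans hc1.1.le : (0 : ℝ) ≤ c) ha hc1.2.le
    have := mul_le_mul_of_nonneg_right this (by linarith : 0 ≤ a - b)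
    linarith

theorem IsPotential.continuousOn {Φ Ψ : ℝ → ℝ} (hΦ : IsPotential Φ Ψ) :
    ContinuousOn Φ (Ici 0) := fun r hr => (hΦ r hr).continuousWithinAt

theorem IsPotential.monotoneOn {Φ Ψ : ℝ → ℝ} {μ : ℝ} (hΦ : IsPotential Φ Ψ)
    (hΨ : IsForce Ψ μ) : MonotoneOn Φ (Ici 0) := by
  intro a ha b hb hab
  have h1 := hΦ.force_mul_sub_le hΨ ha hb
  have h2 := mul_nonneg (hΨ.force_nonneg ha) (sub_nonneg.2 hab)
  linarith

/-! ### The box profile and the height of the distance profile -/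

theorem integral_cell {L : ℝ} (hL : 0 < L) (f : ℝ → ℝ) :
    ∫ x, f x ∂cell L = ∫ x in (-L)..L, f x := by
  rw [intervalIntegral.integral_of_le (by linarith), cell, integral_Icc_eq_integral_Ioc]

theorem eLpNorm_two_eq_one_iff {L : ℝ} (hL : 0 < L) {V : ℝ → ℝ} (hV : MemLp V 2 (cell L)) :
    eLpNorm V 2 (cell L) = 1 ↔ ∫ x in (-L)..L, V x ^ 2 = 1 := by
  rw [hV.eLpNorm_eq_integral_rpow_norm (by norm_num) (by norm_num), ENNReal.ofReal_eq_one,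
    ← integral_cell hL]
  have h0 : 0 ≤ ∫ x, V x ^ 2 ∂cell L := integral_nonneg fun x => sq_nonneg _
  simp only [ENNReal.toReal_ofNat, Real.rpow_ofNat, Real.norm_eq_abs, sq_abs]
  rw [Real.rpow_inv_eq h0 zero_le_one (by norm_num), Real.one_rpow]

theorem intervalIntegrable_mul_of_memLp {L : ℝ} (hL : 0 < L) {V W : ℝ → ℝ} (hV : MemLp V 2 (cell L))
    (hW : MemLp W 2 (cell L)) : IntervalIntegrable (fun x => V x * W x) volume (-L) L := by
  rw [intervalIntegrable_iff_integrableOn_Icc_of_le (by linarith)]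
  exact hV.integrable_mul hW

theorem memLp_cell_of_continuous {L : ℝ} {f : ℝ → ℝ} (hf : Continuous f) (p : ℝ≥0∞) :
    MemLp f p (cell L) := by
  obtain ⟨M, hM⟩ := (isCompact_Icc (a := -L) (b := L)).exists_bound_of_continuousOn hf.continuousOn
  have : IsFiniteMeasure (cell L) := by unfold cell; infer_instance
  refine MemLp.of_bound hf.aestronglyMeasurable M ?_
  exact (ae_restrict_iff' measurableSet_Icc).2 (Filter.Eventually.of_forall hM)

theorem admissible.integral_sq {L : ℝ} (hL : 0 < L) {V : ℝ → ℝ} (hV : V ∈ admissible L) :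
    ∫ x in (-L)..L, V x ^ 2 = 1 := (eLpNorm_two_eq_one_iff hL hV.2.1).1 hV.2.2.1

/-- The `2L`-periodic extension of the indicator function of `[-1/2, 1/2]`, the limit profile. -/
noncomputable def boxWave (L : ℝ) : ℝ → ℝ :=
  indicator {x | ∃ n : ℤ, |x - n * (2 * L)| ≤ 1 / 2} 1

theorem measurable_boxWave (L : ℝ) : Measurable (boxWave L) := by
  refine measurable_one.indicator ?_
  have : {x : ℝ | ∃ n : ℤ, |x - n * (2 * L)| ≤ 1 / 2}
      = ⋃ n : ℤ, {x : ℝ | |x - n * (2 * L)| ≤ 1 / 2} := by ext; simp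
  rw [this]
  exact MeasurableSet.iUnion fun n => measurableSet_le (by fun_prop) measurable_const

theorem boxWave_periodic (L : ℝ) : Function.Periodic (boxWave L) (2 * L) := by
  intro x
  unfold boxWave
  simp only [indicator, mem_ofPred_eq]
  congr 1
  refine propext ⟨?_, ?_⟩
  · rintro ⟨n, hn⟩
    refine ⟨n - 1, ?_⟩
    rw [show x - ((n - 1 : ℤ) : ℝ) * (2 * L) = x + 2 * L - n * (2 * L) by push_cast; ring]
    exact hn
  · rintro ⟨n, hn⟩
    refine ⟨n + 1, ?_⟩
    rw [show x + 2 * L - ((n + 1 : ℤ) : ℝ) * (2 * L) = x - n * (2 * L) by push_cast; ring]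
    exact hn

theorem boxWave_of_abs_le {L x : ℝ} (hx : |x| ≤ 1 / 2) : boxWave L x = 1 :=
  indicator_of_mem (s := {x : ℝ | ∃ n : ℤ, |x - n * (2 * L)| ≤ 1 / 2})
    ⟨0, by simpa using hx⟩ _

theorem boxWave_of_lt {L x : ℝ} (hL : 2 < L) (hx : 1 / 2 < |x|) (hxL : |x| ≤ L) :
    boxWave L x = 0 := by
  refine indicator_of_notMem ?_ _
  rintro ⟨n, hn⟩
  rcases eq_or_ne n 0 with rfl | h0
  · simp at hn; linarith
  · have h1 : (1 : ℝ) ≤ |(n : ℝ)| := by exact_mod_cast Int.one_le_abs h0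
    have h2 : |(n : ℝ) * (2 * L)| ≤ |x| + |x - n * (2 * L)| := by
      have := abs_sub x (x - n * (2 * L))
      simpa using this
    rw [abs_mul, abs_of_pos (by linarith : 0 < 2 * L)] at h2
    nlinarith

theorem boxWave_nonneg (L x : ℝ) : 0 ≤ boxWave L x :=
  indicator_nonneg (fun _ _ => zero_le_one) x

theorem boxWave_le_one (L x : ℝ) : boxWave L x ≤ 1 := by
  unfold boxWave
  exact indicator_le_self' (f := (1 : ℝ → ℝ)) (fun _ _ => zero_le_one) x

theorem boxWave_sq (L x : ℝ) : boxWave L x ^ 2 = boxWave L x := by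
  unfold boxWave indicator
  split_ifs <;> simp

theorem memLp_boxWave (L : ℝ) : MemLp (boxWave L) 2 (cell L) := by
  have : IsFiniteMeasure (cell L) := by unfold cell; infer_instance
  refine MemLp.of_bound (measurable_boxWave L).aestronglyMeasurable 1
    (Filter.Eventually.of_forall fun x => ?_)
  rw [Real.norm_eq_abs, abs_of_nonneg (boxWave_nonneg L x)]
  exact boxWave_le_one L x

theorem intervalIntegrable_mul_boxWave (L : ℝ) {V : ℝ → ℝ} {a b : ℝ}
    (hV : IntervalIntegrable V volume a b) :
    IntervalIntegrable (fun x => V x * boxWave L x) volume a b := by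
  rw [intervalIntegrable_iff] at hV ⊢
  refine Integrable.mul_bdd (c := 1) hV (measurable_boxWave L).aestronglyMeasurable
    (Filter.Eventually.of_forall fun x => ?_)
  rw [Real.norm_eq_abs, abs_of_nonneg (boxWave_nonneg L x)]
  exact boxWave_le_one L x

theorem integral_mul_boxWave {L : ℝ} (hL : 2 < L) {V : ℝ → ℝ} {a b : ℝ}
    (hV : ∀ a b, IntervalIntegrable V volume a b)
    (ha : -(1 / 2) ≤ a) (ha' : a ≤ 1 / 2) (hb : 1 / 2 ≤ b) (hbL : b ≤ L) :
    ∫ x in a..b, V x * boxWave L x = ∫ x in a..(1 / 2), V x := by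
  rw [← intervalIntegral.integral_add_adjacent_intervals (b := 1 / 2)
    (intervalIntegrable_mul_boxWave L (hV _ _)) (intervalIntegrable_mul_boxWave L (hV _ _)),
    intervalIntegral.integral_congr_Ioo_of_le (g := V) ha',
    intervalIntegral.integral_congr_Ioo_of_le (g := fun _ => 0) hb]
  · simp
  · intro x hx
    have h : |x| = x := abs_of_nonneg (by linarith [hx.1])
    simp only [boxWave_of_lt hL (x := x) (by rw [h]; exact hx.1) (by rw [h]; linarith [hx.2]),
      mul_zero]
  · intro x hx
    simp only [boxWave_of_abs_le (L := L) (x := x) (abs_le.2 ⟨by linarith [hx.1], hx.2.le⟩),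
      mul_one]

theorem integral_cell_mul_boxWave {L : ℝ} (hL : 2 < L) {V : ℝ → ℝ}
    (hV : ∀ a b, IntervalIntegrable V volume a b) :
    ∫ x in (-L)..L, V x * boxWave L x = avg V 0 := by
  rw [← intervalIntegral.integral_add_adjacent_intervals (b := -(1 / 2))
    (intervalIntegrable_mul_boxWave L (hV _ _)) (intervalIntegrable_mul_boxWave L (hV _ _)),
    integral_mul_boxWave hL hV le_rfl (by norm_num) (by linarith) le_rfl,
    intervalIntegral.integral_congr_Ioo_of_le (g := fun _ => 0) (by linarith : -L ≤ -(1 / 2))]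
  · simp [avg]
  · intro x hx
    have h : |x| = -x := abs_of_nonpos (by linarith [hx.2])
    simp only [boxWave_of_lt hL (x := x) (by rw [h]; linarith [hx.2]) (by rw [h]; linarith [hx.1]),
      mul_zero]

theorem boxWave_mem_cone {L : ℝ} (hL : 2 < L) : boxWave L ∈ cone L := by
  refine ⟨∅, by simp, fun x y _ _ h0 hxy hy => ?_⟩
  have hx : |x| = x := abs_of_nonneg h0
  refine ⟨?_, ?_, boxWave_nonneg L y⟩
  · rcases le_or_gt x (1 / 2) with h | h
    · rw [boxWave_of_abs_le (by rwa [abs_neg, hx]), boxWave_of_abs_le (by rwa [hx])]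
    · rw [boxWave_of_lt hL (by rwa [abs_neg, hx]) (by rw [abs_neg, hx]; linarith),
        boxWave_of_lt hL (by rwa [hx]) (by rw [hx]; linarith)]
  · rcases le_or_gt x (1 / 2) with h | h
    · rw [boxWave_of_abs_le (x := x) (by rwa [hx])]; exact boxWave_le_one L y
    · have hy' : |y| = y := abs_of_nonneg (h0.trans hxy)
      rw [boxWave_of_lt hL (x := y) (by rw [hy']; linarith) (by rwa [hy'])]
      exact boxWave_nonneg L x

theorem boxWave_mem_admissible {L : ℝ} (hL : 2 < L) : boxWave L ∈ admissible L := by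
  refine ⟨boxWave_periodic L, memLp_boxWave L, ?_, boxWave_mem_cone hL⟩
  rw [eLpNorm_two_eq_one_iff (by linarith) (memLp_boxWave L)]
  have := integral_cell_mul_boxWave hL (V := fun _ => 1) fun a b => by simp
  simp only [one_mul] at this
  simp only [boxWave_sq, this, avg]
  norm_num

theorem avg_boxWave {L : ℝ} (hL : 2 < L) {x : ℝ} (h0 : 0 ≤ x) (h1 : x ≤ 1) :
    avg (boxWave L) x = 1 - x := by
  have := integral_mul_boxWave hL (V := fun _ => 1) (a := x - 1 / 2) (b := x + 1 / 2)
    (fun a b => by simp) (by linarith) (by linarith) (by linarith) (by linarith)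
  simp only [one_mul] at this
  rw [avg, this, intervalIntegral.integral_const, smul_eq_mul]
  ring

theorem sq_integral_le_of_unit_interval {f : ℝ → ℝ} {a b : ℝ} (hab : b - a = 1)
    (hf : IntervalIntegrable f volume a b)
    (hf2 : IntervalIntegrable (fun x => f x ^ 2) volume a b) :
    (∫ x in a..b, f x) ^ 2 ≤ ∫ x in a..b, f x ^ 2 := by
  set c := ∫ x in a..b, f x with hc
  have h : 0 ≤ ∫ x in a..b, (f x - c) ^ 2 :=
    intervalIntegral.integral_nonneg (by linarith) fun x _ => sq_nonneg _
  have e : ∀ x, (f x - c) ^ 2 = f x ^ 2 - 2 * c * f x + c ^ 2 := fun x => by ring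
  simp only [e] at h
  rw [intervalIntegral.integral_add (hf2.sub (hf.const_mul _)) (by simp),
    intervalIntegral.integral_sub hf2 (hf.const_mul _), intervalIntegral.integral_const_mul,
    intervalIntegral.integral_const, hab, ← hc, smul_eq_mul] at h
  nlinarith

/-- The distance profile of an admissible function is close to the tent profile as soon as its
value at `0` is close to `1`: that value is the `L²` inner product with the box. -/
theorem admissible.sq_avg_sub_tent_le {L : ℝ} (hL : 2 < L) {V : ℝ → ℝ} (hV : V ∈ admissible L)
    {x : ℝ} (h0 : 0 ≤ x) (h1 : x ≤ 1) :
    (avg V x - (1 - x)) ^ 2 ≤ 2 * (1 - avg V 0) := by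
  have hi := admissible.intervalIntegrable hL hV
  have hib : ∀ a b, IntervalIntegrable (boxWave L) volume a b := fun a b => by
    simpa using intervalIntegrable_mul_boxWave L (V := fun _ => 1) (a := a) (b := b) (by simp)
  have hV2 : IntervalIntegrable (fun x => V x ^ 2) volume (-L) L := by
    simpa [sq] using intervalIntegrable_mul_of_memLp (by linarith) hV.2.1 hV.2.1
  have e : ∀ x, (V x - boxWave L x) ^ 2 = V x ^ 2 - 2 * (V x * boxWave L x) + boxWave L x := by
    intro x
    have := boxWave_sq L x
    linear_combination this
  have hd2 : IntervalIntegrable (fun x => (V x - boxWave L x) ^ 2) volume (-L) L := by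
    simp only [e]
    exact (hV2.sub ((intervalIntegrable_mul_boxWave L (hi _ _)).const_mul 2)).add (hib _ _)
  have e1 : avg V x - (1 - x) = ∫ t in (x - 1 / 2)..(x + 1 / 2), (V t - boxWave L t) := by
    rw [intervalIntegral.integral_sub (hi _ _) (hib _ _), ← avg_boxWave hL h0 h1, avg, avg]
  have e2 : ∫ t in (-L)..L, (V t - boxWave L t) ^ 2 = 2 * (1 - avg V 0) := by
    have hb := integral_cell_mul_boxWave hL (V := fun _ => 1) fun a b => by simp
    have hb' : avg (fun _ => (1 : ℝ)) 0 = 1 := by simp [avg]; norm_num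
    simp only [one_mul, hb'] at hb
    simp only [e]
    rw [intervalIntegral.integral_add
      (hV2.sub ((intervalIntegrable_mul_boxWave L (hi _ _)).const_mul 2)) (hib _ _),
      intervalIntegral.integral_sub hV2 ((intervalIntegrable_mul_boxWave L (hi _ _)).const_mul 2),
      intervalIntegral.integral_const_mul, integral_cell_mul_boxWave hL hi, hb,
      admissible.integral_sq (by linarith) hV]
    ring
  have hsub : uIcc (x - 1 / 2) (x + 1 / 2) ⊆ uIcc (-L) L := by
    rw [uIcc_of_le (by linarith), uIcc_of_le (by linarith)]
    exact Icc_subset_Icc (by linarith) (by linarith)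
  rw [e1, ← e2]
  refine (sq_integral_le_of_unit_interval (by ring) ((hi _ _).sub (hib _ _))
    (hd2.mono_set hsub)).trans ?_
  refine intervalIntegral.integral_mono_interval (by linarith) (by linarith) (by linarith) ?_ hd2
  exact Filter.Eventually.of_forall fun x => sq_nonneg _

theorem admissible.avg_zero_le_one {L : ℝ} (hL : 2 < L) {V : ℝ → ℝ} (hV : V ∈ admissible L) :
    avg V 0 ≤ 1 := by
  have := admissible.sq_avg_sub_tent_le hL hV le_rfl zero_le_one
  nlinarith [sq_nonneg (avg V 0 - (1 - 0))]

/-- A maximizer has an almost optimal distance value at `0`: its energy dominates the energy of the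
box profile, and the energy density at levels below `1 - 2η` is exponentially smaller than at
`1 - η`. -/
theorem IsForce.exists_lt_avg_zero {Ψ : ℝ → ℝ} {μ : ℝ} (hΨ : IsForce Ψ μ) {L : ℝ} (hL : 2 < L)
    {η : ℝ} (hη : 0 < η) (hη1 : η < 1 / 2) :
    ∃ δ₀ : ℝ, 0 < δ₀ ∧ ∀ Φ : ℝ → ℝ, IsPotential Φ Ψ → ∀ δ, 0 < δ → δ < δ₀ →
      ∀ V, IsMaximizer Φ L δ V → 1 - 2 * η < avg V 0 := by
  -- On `[0, η]` the box has energy density at least `Φ((1 - η) / δ)`, and by convexity this exceeds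
  -- `Φ(0)` by a multiple of the force at the intermediate level `1 - 3η/2`.
  obtain ⟨δ₁, h₁, hδ₁⟩ := hΨ.exists_force_le (a := 1 - 2 * η) (b := 1 - 3 / 2 * η)
    (by linarith) (by linarith) 1
  refine ⟨min δ₁ (η ^ 2 / (4 * L)), lt_min h₁ (by positivity), fun Φ hΦ δ hδ hlt V hV => ?_⟩
  have l1 : δ < δ₁ := hlt.trans_le (min_le_left _ _)
  have l2 : δ < η ^ 2 / (4 * L) := hlt.trans_le (min_le_right _ _)
  by_contra! hcon
  have hbox := boxWave_mem_admissible hL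
  have bellV : IsBell L (avg V) :=
    isBell_avg hL hV.1.1 (admissible.intervalIntegrable hL hV.1) hV.1.2.2.2
  have bellU : IsBell L (avg (boxWave L)) :=
    isBell_avg hL hbox.1 (admissible.intervalIntegrable hL hbox) hbox.2.2.2
  have hcont : ∀ W, IsBell L W → Continuous fun x => Φ (W x / δ) := fun W hW =>
    hΦ.continuousOn.comp_continuous (hW.cont.div_const δ) fun x => div_nonneg (hW.nonneg x) hδ.le
  have mono : ∀ {a b}, 0 ≤ a → a ≤ b → Φ (a / δ) ≤ Φ (b / δ) := fun {a b} ha hab =>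
    hΦ.monotoneOn hΨ (div_nonneg ha hδ.le : 0 ≤ a / δ)
      (div_nonneg (ha.trans hab) hδ.le : 0 ≤ b / δ) (by gcongr)
  -- upper bound for the energy of the maximizer
  have up : energy Φ L δ V ≤ 2 * L * Φ ((1 - 2 * η) / δ) := by
    have : ∫ x in (-L)..L, Φ (avg V x / δ) ≤ ∫ x in (-L)..L, Φ ((1 - 2 * η) / δ) := by
      refine intervalIntegral.integral_mono_on (by linarith)
        ((hcont _ bellV).intervalIntegrable _ _) (by simp) fun x hx => ?_
      refine mono (bellV.nonneg x) (le_trans ?_ hcon)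
      rcases le_total 0 x with h | h
      · exact bellV.anti (left_mem_Icc.2 (by linarith)) ⟨h, hx.2⟩ h
      · rw [← bellV.even]
        exact bellV.anti (left_mem_Icc.2 (by linarith)) ⟨by linarith, by linarith [hx.1]⟩
          (by linarith)
    refine this.trans (le_of_eq ?_)
    rw [intervalIntegral.integral_const, smul_eq_mul]; ring
  -- lower bound for the energy of the box
  have low : 2 * L * Φ 0 + η * (Φ ((1 - η) / δ) - Φ 0) ≤ energy Φ L δ (boxWave L) := by
    have hi : ∀ a b, IntervalIntegrable (fun x => Φ (avg (boxWave L) x / δ)) volume a b :=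
      fun a b => (hcont _ bellU).intervalIntegrable a b
    have h0 : ∀ x, Φ 0 ≤ Φ (avg (boxWave L) x / δ) := fun x => by
      simpa using mono le_rfl (bellU.nonneg x)
    have i1 : ∫ x in (-L)..0, Φ 0 ≤ ∫ x in (-L)..0, Φ (avg (boxWave L) x / δ) :=
      intervalIntegral.integral_mono_on (by linarith) (by simp) (hi _ _) fun x _ => h0 x
    have i2 : ∫ x in (0 : ℝ)..η, Φ ((1 - η) / δ) ≤ ∫ x in (0 : ℝ)..η, Φ (avg (boxWave L) x / δ) :=
      intervalIntegral.integral_mono_on (by linarith) (by simp) (hi _ _) fun x hx => by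
        rw [avg_boxWave hL hx.1 (by linarith [hx.2])]
        exact mono (by linarith) (by linarith [hx.2])
    have i3 : ∫ x in η..L, Φ 0 ≤ ∫ x in η..L, Φ (avg (boxWave L) x / δ) :=
      intervalIntegral.integral_mono_on (by linarith) (by simp) (hi _ _) fun x _ => h0 x
    rw [intervalIntegral.integral_const, smul_eq_mul] at i1 i2 i3
    rw [energy, ← intervalIntegral.integral_add_adjacent_intervals (hi (-L) 0) (hi 0 L),
      ← intervalIntegral.integral_add_adjacent_intervals (hi 0 η) (hi η L)]
    linarith
  have hmax := hV.2 _ hbox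
  have c1 := hΦ.force_mul_sub_le hΨ (a := (1 - 3 / 2 * η) / δ) (b := (1 - η) / δ)
    (div_nonneg (by linarith) hδ.le) (div_nonneg (by linarith) hδ.le)
  have c2 := hΦ.force_mul_sub_le hΨ (a := (1 - 2 * η) / δ) (b := 0)
    (div_nonneg (by linarith) hδ.le) le_rfl
  have c3 := mono le_rfl (by linarith : 0 ≤ 1 - 3 / 2 * η)
  rw [zero_div] at c3
  have c4 := hδ₁ δ hδ l1
  have c5 : 0 < force Ψ ((1 - 3 / 2 * η) / δ) := hΨ.force_pos (div_pos (by linarith) hδ)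
  have c6 : 0 ≤ force Ψ ((1 - 2 * η) / δ) := hΨ.force_nonneg (div_nonneg (by linarith) hδ.le)
  set f1 := force Ψ ((1 - 3 / 2 * η) / δ)
  set f2 := force Ψ ((1 - 2 * η) / δ)
  have c7 : η * (f1 * (η / 2)) ≤ 2 * L * f2 := by
    have d1 : f1 * ((1 - η) / δ - (1 - 3 / 2 * η) / δ) = f1 * (η / 2) / δ := by ring
    have d2 : f2 * (0 - (1 - 2 * η) / δ) = -(f2 * (1 - 2 * η) / δ) := by ring
    rw [d1] at c1
    rw [d2] at c2
    have d3 : η * (f1 * (η / 2) / δ) ≤ 2 * L * (f2 * (1 - 2 * η) / δ) := by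
      have := mul_le_mul_of_nonneg_left (c1.trans (by linarith : _ ≤ Φ ((1 - η) / δ) - Φ 0)) hη.le
      have := mul_le_mul_of_nonneg_left c2 (by linarith : 0 ≤ 2 * L)
      linarith
    have d4 : η * (f1 * (η / 2)) ≤ 2 * L * (f2 * (1 - 2 * η)) := by
      have := mul_le_mul_of_nonneg_right d3 hδ.le
      have g1 : η * (f1 * (η / 2) / δ) * δ = η * (f1 * (η / 2)) := by field_simp
      have g2 : 2 * L * (f2 * (1 - 2 * η) / δ) * δ = 2 * L * (f2 * (1 - 2 * η)) := by field_simp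
      rwa [g1, g2] at this
    refine d4.trans ?_
    have : f2 * (1 - 2 * η) ≤ f2 := by nlinarith
    gcongr
  rw [pow_one] at c4
  have c8 : 2 * L * f2 ≤ 2 * L * (δ * f1) := by gcongr
  rw [lt_div_iff₀ (by linarith)] at l2
  have : f1 * (δ * (4 * L)) < f1 * η ^ 2 := by gcongr
  linarith

/-! ### The Euler–Lagrange equation -/

theorem ae_eq_of_ae_eq_cell {L : ℝ} (hL : 0 < L) {V W : ℝ → ℝ}
    (hV : Function.Periodic V (2 * L)) (hW : Function.Periodic W (2 * L))
    (h : V =ᵐ[cell L] W) : V =ᵐ[volume] W := by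
  have h0 : ∀ᵐ t, t ∈ Icc (-L) L → V t = W t := (ae_restrict_iff' measurableSet_Icc).1 h
  have h1 : ∀ᵐ t : ℝ, ∀ n : ℤ, t + -(n * (2 * L)) ∈ Icc (-L) L →
      V (t + -(n * (2 * L))) = W (t + -(n * (2 * L))) :=
    ae_all_iff.2 fun n => (measurePreserving_add_const _).quasiMeasurePreserving.ae h0
  filter_upwards [h1] with t ht
  obtain ⟨n, hn⟩ := exists_abs_sub_le hL t
  have := ht n (by rw [← sub_eq_add_neg]; exact abs_le.1 hn)
  rwa [← sub_eq_add_neg, hV.sub_int_mul_eq, hW.sub_int_mul_eq] at this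

theorem avg_div_const (f : ℝ → ℝ) (σ x : ℝ) : avg (fun t => f t / σ) x = avg f x / σ := by
  simp only [avg, intervalIntegral.integral_div]

theorem IsBell.div_const {L : ℝ} {f : ℝ → ℝ} (hf : IsBell L f) {σ : ℝ} (hσ : 0 ≤ σ) :
    IsBell L (fun x => f x / σ) :=
  hf.comp (g := fun r => r / σ) (by fun_prop)
    (fun a _ b _ hab => div_le_div_of_nonneg_right hab hσ) fun r hr => div_nonneg hr hσ

theorem IsForce.isBell_force {Ψ : ℝ → ℝ} {μ : ℝ} (hΨ : IsForce Ψ μ) {L δ : ℝ} (hδ : 0 ≤ δ)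
    {R : ℝ → ℝ} (hR : IsBell L R) : IsBell L (fun x => force Ψ (R x / δ)) :=
  (hR.div_const hδ).comp (g := force Ψ) hΨ.continuousOn_force hΨ.monotoneOn_force
    fun _ hr => hΨ.force_nonneg hr

/-- The Euler–Lagrange equation. The cone constraint produces no extra multiplier: the normalized
gradient of the energy is itself admissible, and by convexity of the energy a maximizer can only be
a fixed point of this improvement step. -/
theorem IsMaximizer.exists_euler_lagrange {Ψ : ℝ → ℝ} {μ : ℝ} (hΨ : IsForce Ψ μ) {L : ℝ}
    (hL : 2 < L) {Φ : ℝ → ℝ} (hΦ : IsPotential Φ Ψ) {δ : ℝ} (hδ : 0 < δ) {V : ℝ → ℝ}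
    (hV : IsMaximizer Φ L δ V) (h0 : 0 < avg V 0) :
    ∃ σ : ℝ, 0 < σ ∧ V =ᵐ[volume] avg (fun x => force Ψ (avg V x / δ) / σ) := by
  have hL0 : 0 < L := by linarith
  have hVi := admissible.intervalIntegrable hL hV.1
  have bellR : IsBell L (avg V) := isBell_avg hL hV.1.1 hVi hV.1.2.2.2
  set f : ℝ → ℝ := fun x => force Ψ (avg V x / δ) with hf
  have bellf : IsBell L f := hΨ.isBell_force hδ.le bellR
  have bellg : IsBell L (avg f) := bellf.bell_avg hL
  have g0 : 0 < avg f 0 := by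
    refine intervalIntegral.integral_pos (by norm_num) bellf.cont.continuousOn
      (fun x _ => bellf.nonneg x) ⟨0, by constructor <;> norm_num, hΨ.force_pos (div_pos h0 hδ)⟩
  have n0 : 0 < ∫ x in (-L)..L, avg f x ^ 2 :=
    intervalIntegral.integral_pos (by linarith) (bellg.cont.pow 2).continuousOn
      (fun x _ => sq_nonneg _) ⟨0, ⟨by linarith, by linarith⟩, by positivity⟩
  set σ := Real.sqrt (∫ x in (-L)..L, avg f x ^ 2) with hσ
  have σ0 : 0 < σ := Real.sqrt_pos.2 n0
  have σ2 : σ ^ 2 = ∫ x in (-L)..L, avg f x ^ 2 := Real.sq_sqrt n0.le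
  set U : ℝ → ℝ := avg (fun x => f x / σ) with hU
  have Ue : ∀ x, U x = avg f x / σ := fun x => avg_div_const f σ x
  have bellU : IsBell L U := (bellf.div_const σ0.le).bell_avg hL
  have U2 : ∫ x in (-L)..L, U x ^ 2 = 1 := by
    simp only [Ue, div_pow, intervalIntegral.integral_div]
    rw [← σ2]; field_simp
  have hUadm : U ∈ admissible L :=
    ⟨bellU.periodic, memLp_cell_of_continuous bellU.cont 2,
      (eLpNorm_two_eq_one_iff hL0 (memLp_cell_of_continuous bellU.cont 2)).2 U2, bellU.mem_cone⟩
  have bellRU : IsBell L (avg U) := bellU.bell_avg hL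
  refine ⟨σ, σ0, ae_eq_of_ae_eq_cell hL0 hV.1.1 bellU.periodic ?_⟩
  -- convexity of the energy
  have key : ∫ x in (-L)..L, f x * avg U x ≤ ∫ x in (-L)..L, f x * avg V x := by
    have hcont : ∀ W, IsBell L W → Continuous fun x => Φ (W x / δ) := fun W hW =>
      hΦ.continuousOn.comp_continuous (hW.cont.div_const δ) fun x => div_nonneg (hW.nonneg x) hδ.le
    have h1 : ∫ x in (-L)..L, (f x * avg U x - f x * avg V x) / δ
        ≤ ∫ x in (-L)..L, (Φ (avg U x / δ) - Φ (avg V x / δ)) := by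
      refine intervalIntegral.integral_mono_on (by linarith)
        ((((bellf.cont.mul bellRU.cont).sub (bellf.cont.mul bellR.cont)).div_const
          δ).intervalIntegrable _ _)
        (((hcont _ bellRU).sub (hcont _ bellR)).intervalIntegrable _ _) fun x _ => ?_
      refine le_trans (le_of_eq ?_) (hΦ.force_mul_sub_le hΨ
        (div_nonneg (bellR.nonneg x) hδ.le) (div_nonneg (bellRU.nonneg x) hδ.le))
      simp only [hf]; ring
    rw [intervalIntegral.integral_div, intervalIntegral.integral_sub
      (f := fun x => f x * avg U x) (g := fun x => f x * avg V x)
      ((bellf.cont.mul bellRU.cont).intervalIntegrable _ _)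
      ((bellf.cont.mul bellR.cont).intervalIntegrable _ _), intervalIntegral.integral_sub
      ((hcont _ bellRU).intervalIntegrable _ _) ((hcont _ bellR).intervalIntegrable _ _)] at h1
    have h2 := hV.2 U hUadm
    unfold energy at h2
    have h3 := h1.trans (sub_nonpos.2 h2)
    rw [div_le_iff₀ hδ, zero_mul] at h3
    linarith
  have sym : ∀ W, Function.Periodic W (2 * L) → (∀ a b, IntervalIntegrable W volume a b) →
      ∫ x in (-L)..L, f x * avg W x = σ * ∫ x in (-L)..L, U x * W x := by
    intro W hW hWi
    have := integral_mul_avg (a := -L) (by linarith : 0 < 2 * L) bellf.cont bellf.periodic hW hWi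
    rw [show -L + 2 * L = L by ring] at this
    rw [this, ← intervalIntegral.integral_const_mul]
    congr 1; ext x
    rw [Ue]; field_simp
  have hUi : ∀ a b, IntervalIntegrable U volume a b := fun a b => bellU.cont.intervalIntegrable a b
  rw [sym U bellU.periodic hUi, sym V hV.1.1 hVi] at key
  have key2 : 1 ≤ ∫ x in (-L)..L, U x * V x := by
    have := le_of_mul_le_mul_left key σ0
    simpa only [← sq, U2] using this
  have mU : MemLp U 2 (cell L) := hUadm.2.1
  have mV : MemLp V 2 (cell L) := hV.1.2.1
  have hsq : ∫ x, (V x - U x) ^ 2 ∂cell L = 0 := by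
    refine le_antisymm ?_ (integral_nonneg fun x => sq_nonneg _)
    have e : ∀ x, (V x - U x) ^ 2 = V x * V x - 2 * (U x * V x) + U x * U x := fun x => by ring
    have V2 := admissible.integral_sq hL0 hV.1
    simp only [sq] at V2 U2
    simp only [e]
    rw [integral_cell hL0, intervalIntegral.integral_add, intervalIntegral.integral_sub,
      intervalIntegral.integral_const_mul, U2, V2]
    · linarith
    · exact intervalIntegrable_mul_of_memLp hL0 mV mV
    · exact (intervalIntegrable_mul_of_memLp hL0 mU mV).const_mul 2
    · exact (intervalIntegrable_mul_of_memLp hL0 mV mV).sub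
        ((intervalIntegrable_mul_of_memLp hL0 mU mV).const_mul 2)
    · exact intervalIntegrable_mul_of_memLp hL0 mU mU
  have hint : Integrable (fun x => (V x - U x) ^ 2) (cell L) := (mV.sub mU).integrable_sq
  rw [integral_eq_zero_iff_of_nonneg (fun x => sq_nonneg _) hint] at hsq
  filter_upwards [hsq] with x hx
  have : (V x - U x) ^ 2 = 0 := hx
  exact sub_eq_zero.1 (pow_eq_zero_iff (two_ne_zero) |>.1 this)

/-! ### Waves and their densities -/

/-- The primitive of `f` that vanishes at `0`. -/
noncomputable def prim (f : ℝ → ℝ) (x : ℝ) : ℝ := ∫ t in (0 : ℝ)..x, f t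

section Prim

variable {L : ℝ} {f : ℝ → ℝ}

theorem IsBell.hasDerivAt_prim (hf : IsBell L f) (x : ℝ) : HasDerivAt (prim f) (f x) x :=
  intervalIntegral.integral_hasDerivAt_right (hf.cont.intervalIntegrable _ _)
    (hf.cont.stronglyMeasurableAtFilter _ _) hf.cont.continuousAt

theorem IsBell.continuous_prim (hf : IsBell L f) : Continuous (prim f) :=
  continuous_iff_continuousAt.2 fun x => (hf.hasDerivAt_prim x).continuousAt

theorem prim_zero (f : ℝ → ℝ) : prim f 0 = 0 := by simp [prim]

theorem IsBell.prim_sub (hf : IsBell L f) (a b : ℝ) : prim f b - prim f a = ∫ t in a..b, f t :=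
  intervalIntegral.integral_interval_sub_left (hf.cont.intervalIntegrable _ _)
    (hf.cont.intervalIntegrable _ _)

theorem IsBell.prim_neg (hf : IsBell L f) (x : ℝ) : prim f (-x) = -prim f x := by
  have := intervalIntegral.integral_comp_neg (a := 0) (b := x) f
  simp only [hf.even, neg_zero] at this
  rw [prim, prim, this, intervalIntegral.integral_symm]

theorem IsBell.monotone_prim (hf : IsBell L f) : Monotone (prim f) := fun a b hab => by
  rw [← sub_nonneg, hf.prim_sub]
  exact intervalIntegral.integral_nonneg hab fun x _ => hf.nonneg x

theorem IsBell.prim_nonneg (hf : IsBell L f) {x : ℝ} (hx : 0 ≤ x) : 0 ≤ prim f x := by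
  rw [← prim_zero f]; exact hf.monotone_prim hx

theorem IsBell.avg_eq (hf : IsBell L f) (x : ℝ) :
    avg f x = prim f (x + 1 / 2) - prim f (x - 1 / 2) := by
  rw [hf.prim_sub, avg]

theorem IsBell.avg_zero (hf : IsBell L f) : avg f 0 = 2 * prim f (1 / 2) := by
  rw [hf.avg_eq, zero_add, zero_sub, hf.prim_neg]; ring

theorem IsBell.prim_reflect (hf : IsBell L f) (x : ℝ) :
    prim f (2 * L - x) = 2 * prim f L - prim f x := by
  have h := intervalIntegral.integral_comp_sub_left (a := x) (b := L) f (2 * L)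
  have e : ∀ t, f (2 * L - t) = f t := fun t => by
    rw [← hf.even t, ← hf.periodic (-t)]; congr 1; ring
  simp only [e] at h
  rw [show 2 * L - L = L by ring, ← hf.prim_sub, ← hf.prim_sub] at h
  linarith

theorem IsBell.le_of_le (hf : IsBell L f) {x y : ℝ} (h0 : 0 ≤ x) (hxy : x ≤ y) (hy : y ≤ L) :
    f y ≤ f x := hf.anti ⟨h0, hxy.trans hy⟩ ⟨h0.trans hxy, hy⟩ hxy

theorem IsBell.prim_sub_le (hf : IsBell L f) {a b : ℝ} (ha : 0 ≤ a) (hab : a ≤ b) (hb : b ≤ L) :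
    prim f b - prim f a ≤ (b - a) * f a := by
  rw [hf.prim_sub]
  have : ∫ t in a..b, f t ≤ ∫ _ in a..b, f a :=
    intervalIntegral.integral_mono_on hab (hf.cont.intervalIntegrable _ _) (by simp)
      fun x hx => hf.le_of_le ha hx.1 (hx.2.trans hb)
  simpa using this

theorem IsBell.mul_le_prim (hf : IsBell L f) {x : ℝ} (hx : 0 ≤ x) (hxL : x ≤ L) :
    x * f x ≤ prim f x := by
  have : ∫ _ in (0 : ℝ)..x, f x ≤ ∫ t in (0 : ℝ)..x, f t :=
    intervalIntegral.integral_mono_on hx (by simp) (hf.cont.intervalIntegrable _ _)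
      fun t ht => hf.le_of_le ht.1 ht.2 hxL
  simpa [prim] using this

theorem IsBell.prim_le_mul (hf : IsBell L f) {x : ℝ} (hx : 0 ≤ x) (hxL : x ≤ L) :
    prim f x ≤ x * f 0 := by
  have := hf.prim_sub_le le_rfl hx hxL
  simpa [prim_zero] using this

end Prim

/-- The rescaled force `Φ'(R / δ) / σ` along a distance profile `R`. -/
noncomputable def density (Ψ : ℝ → ℝ) (δ σ : ℝ) (R : ℝ → ℝ) (x : ℝ) : ℝ := force Ψ (R x / δ) / σ

/-- `R` is the distance profile of a normalized solution `V = 𝒜 G`, `G = Φ'(R / δ) / σ`, of the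
Euler–Lagrange equation that is close to the tent profile. The fixed tolerance `1/32` suffices to
separate the levels of `R` at the points `1/8`, `1/4` and `3/4`. -/
structure IsWave (Ψ : ℝ → ℝ) (L δ σ : ℝ) (R : ℝ → ℝ) : Prop where
  delta_pos : 0 < δ
  sigma_pos : 0 < σ
  bell : IsBell L R
  eq_avg : R = avg (avg (density Ψ δ σ R))
  norm : ∫ x in (-L)..L, avg (density Ψ δ σ R) x ^ 2 = 1
  apex_le : R 0 ≤ 1
  tent : ∀ x, 0 ≤ x → x ≤ 1 → |R x - (1 - x)| ≤ 1 / 32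

theorem IsForce.exists_isWave {Ψ : ℝ → ℝ} {μ : ℝ} (hΨ : IsForce Ψ μ) {L : ℝ} (hL : 2 < L) :
    ∃ δ₀ : ℝ, 0 < δ₀ ∧ ∀ Φ : ℝ → ℝ, IsPotential Φ Ψ → ∀ δ, 0 < δ → δ < δ₀ →
      ∀ V, IsMaximizer Φ L δ V → ∃ σ, IsWave Ψ L δ σ (avg V) ∧
        V =ᵐ[volume] avg (density Ψ δ σ (avg V)) := by
  -- `R(0) > 1 - 1/2048` makes the distance to the tent at most `√(2 / 2048) = 1/32`.
  obtain ⟨δ₀, h0, h⟩ := hΨ.exists_lt_avg_zero hL (η := 1 / 4096) (by norm_num) (by norm_num)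
  refine ⟨δ₀, h0, fun Φ hΦ δ hδ hlt V hV => ?_⟩
  have hR := h Φ hΦ δ hδ hlt V hV
  obtain ⟨σ, hσ, hae⟩ := hV.exists_euler_lagrange hΨ hL hΦ hδ (by linarith)
  refine ⟨σ, ⟨hδ, hσ, isBell_avg hL hV.1.1 (admissible.intervalIntegrable hL hV.1) hV.1.2.2.2,
    avg_congr_ae hae, ?_, admissible.avg_zero_le_one hL hV.1, fun x hx0 hx1 => ?_⟩, hae⟩
  · rw [← admissible.integral_sq (by linarith) hV.1]
    refine intervalIntegral.integral_congr_ae ?_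
    filter_upwards [hae] with x hx _
    rw [hx]; rfl
  · refine abs_le_of_sq_le_sq ?_ (by norm_num)
    refine (admissible.sq_avg_sub_tent_le hL hV.1 hx0 hx1).trans ?_
    linarith

section Wave

variable {Ψ : ℝ → ℝ} {μ L δ σ : ℝ} {R : ℝ → ℝ}

theorem IsWave.bell_density (hw : IsWave Ψ L δ σ R) (hΨ : IsForce Ψ μ) :
    IsBell L (density Ψ δ σ R) :=
  (hΨ.isBell_force hw.delta_pos.le hw.bell).div_const hw.sigma_pos.le

/-- A bound for `K` near the origin: `2 K(1/4) ≤ V(1/4) ≤ 4 ∫₀^{1/4} V ≤ 2 R(0)`. -/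
theorem IsWave.prim_quarter_le (hw : IsWave Ψ L δ σ R) (hΨ : IsForce Ψ μ) (hL : 2 < L) :
    prim (density Ψ δ σ R) (1 / 4) ≤ 1 := by
  have hG := hw.bell_density hΨ
  have hW := hG.bell_avg hL
  have h1 := hW.mul_le_prim (x := 1 / 4) (by norm_num) (by linarith)
  have h2 := hW.monotone_prim (by norm_num : (1 / 4 : ℝ) ≤ 1 / 2)
  have h3 := hW.avg_zero
  rw [← hw.eq_avg] at h3
  have h4 := hw.apex_le
  have h5 := hG.avg_eq (1 / 4)
  rw [show (1 / 4 - 1 / 2 : ℝ) = -(1 / 4) by norm_num, hG.prim_neg] at h5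
  have h6 := hG.monotone_prim (by norm_num : (1 / 4 : ℝ) ≤ 1 / 4 + 1 / 2)
  linarith

/-- The total mass of the density over one period. -/
noncomputable def mass (Ψ : ℝ → ℝ) (L δ σ : ℝ) (R : ℝ → ℝ) : ℝ := 2 * prim (density Ψ δ σ R) L

theorem IsWave.half_le_mass (hw : IsWave Ψ L δ σ R) (hΨ : IsForce Ψ μ) (hL : 2 < L) :
    1 / 2 ≤ mass Ψ L δ σ R := by
  have hG := hw.bell_density hΨ
  have hW := hG.bell_avg hL
  have h1 := hW.prim_le_mul (x := 1 / 2) (by norm_num) (by linarith)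
  have h2 := hG.monotone_prim (by linarith : (1 / 2 : ℝ) ≤ L)
  have h3 := hW.avg_zero
  rw [← hw.eq_avg] at h3
  have h4 := (abs_le.1 (hw.tent 0 le_rfl zero_le_one)).1
  have h5 := hG.avg_zero
  unfold mass
  linarith

theorem IsWave.mass_le (hw : IsWave Ψ L δ σ R) (hΨ : IsForce Ψ μ) (hL : 2 < L) :
    mass Ψ L δ σ R ≤ 2 + 8 * L := by
  have hG := hw.bell_density hΨ
  have h1 := hw.prim_quarter_le hΨ hL
  have h2 := hG.mul_le_prim (x := 1 / 4) (by norm_num) (by linarith)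
  have h3 := hG.prim_sub_le (a := 1 / 4) (b := L) (by norm_num) (by linarith) le_rfl
  unfold mass
  nlinarith [hG.nonneg (1 / 4)]

/-- Different levels of the distance profile are separated by arbitrary powers of `δ` in the
density. The threshold for `δ` does not depend on the wave. -/
theorem IsForce.exists_density_le (hΨ : IsForce Ψ μ) {a b : ℝ} (ha : 0 < a) (hab : a < b) (n : ℕ) :
    ∃ δ₀ : ℝ, 0 < δ₀ ∧ ∀ {L δ σ : ℝ} {R : ℝ → ℝ}, IsWave Ψ L δ σ R → δ < δ₀ →
      ∀ x y, R x ≤ a → b ≤ R y → density Ψ δ σ R x ≤ δ ^ n * density Ψ δ σ R y := by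
  obtain ⟨δ₀, h0, h⟩ := hΨ.exists_force_le ha hab n
  refine ⟨δ₀, h0, fun {L δ σ R} hw hlt x y hx hy => ?_⟩
  have hδ := hw.delta_pos
  unfold density
  rw [mul_div_assoc']
  refine div_le_div_of_nonneg_right ?_ hw.sigma_pos.le
  have hb : 0 ≤ b := by linarith
  calc force Ψ (R x / δ) ≤ force Ψ (a / δ) :=
        hΨ.monotoneOn_force (div_nonneg (hw.bell.nonneg x) hδ.le : 0 ≤ R x / δ)
          (div_nonneg ha.le hδ.le : 0 ≤ a / δ) (by gcongr)
    _ ≤ δ ^ n * force Ψ (b / δ) := h δ hδ hlt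
    _ ≤ δ ^ n * force Ψ (R y / δ) := by
        gcongr
        exact hΨ.monotoneOn_force (div_nonneg hb hδ.le : 0 ≤ b / δ)
          (div_nonneg (hb.trans hy) hδ.le : 0 ≤ R y / δ) (by gcongr)

/-- Smallness of the parameter, as it enters the analysis of a wave on `[0, 1/4]`: the density
drops by a power of `δ` from `1/4` to `3/4` (interaction of neighbouring pulses) and from `1/8` to
`1/4` (mass outside of the bulk). -/
structure IsSmall (Ψ : ℝ → ℝ) (δ σ : ℝ) (R : ℝ → ℝ) : Prop where
  delta_le : δ ≤ 1 / 2
  outer : density Ψ δ σ R (3 / 4) ≤ δ * density Ψ δ σ R (1 / 4)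
  inner : density Ψ δ σ R (1 / 4) ≤ δ ^ 2 * density Ψ δ σ R (1 / 8)
  exp_le : Real.exp (R (1 / 4) / δ) ≤ δ * Real.exp (R (1 / 8) / δ)

theorem IsForce.exists_isSmall (hΨ : IsForce Ψ μ) :
    ∃ δ₀ : ℝ, 0 < δ₀ ∧ ∀ {L δ σ : ℝ} {R : ℝ → ℝ}, IsWave Ψ L δ σ R → δ < δ₀ →
      IsSmall Ψ δ σ R := by
  obtain ⟨δ₁, p1, h1⟩ := hΨ.exists_density_le (a := 9 / 32) (b := 23 / 32) (by norm_num)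
    (by norm_num) 1
  obtain ⟨δ₂, p2, h2⟩ := hΨ.exists_density_le (a := 25 / 32) (b := 27 / 32) (by norm_num)
    (by norm_num) 2
  obtain ⟨δ₃, p3, h3⟩ := exists_exp_neg_div_le (c := 1 / 16) (by norm_num) 1 1
  refine ⟨min (min δ₁ δ₂) (min δ₃ (1 / 2)), by positivity, fun {L δ σ R} hw hlt => ?_⟩
  have hδ := hw.delta_pos
  obtain ⟨⟨l1, l2⟩, l3, l4⟩ := by simpa only [lt_min_iff] using hlt
  have t1 := abs_le.1 (hw.tent (1 / 8) (by norm_num) (by norm_num))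
  have t2 := abs_le.1 (hw.tent (1 / 4) (by norm_num) (by norm_num))
  have t3 := abs_le.1 (hw.tent (3 / 4) (by norm_num) (by norm_num))
  refine ⟨l4.le, ?_, ?_, ?_⟩
  · simpa using h1 hw l1 (3 / 4) (1 / 4) (by linarith) (by linarith)
  · exact h2 hw l2 (1 / 4) (1 / 8) (by linarith) (by linarith)
  · calc Real.exp (R (1 / 4) / δ) ≤ Real.exp (-(1 / 16 / δ) + R (1 / 8) / δ) := by
          gcongr
          rw [← neg_div, ← add_div]
          gcongr
          linarith
      _ ≤ δ * Real.exp (R (1 / 8) / δ) := by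
          rw [Real.exp_add]
          gcongr
          simpa using h3 δ hδ l3

/-- With `K` the primitive of the density, `R' = K(1 + ·) - 2 K + K(· - 1)`, written so that the
contribution of the neighbouring pulses is separated. -/
theorem IsWave.hasDerivAt (hw : IsWave Ψ L δ σ R) (hΨ : IsForce Ψ μ) (hL : 2 < L) (x : ℝ) :
    HasDerivAt R (-(2 * prim (density Ψ δ σ R) x) +
      (prim (density Ψ δ σ R) (1 + x) - prim (density Ψ δ σ R) (1 - x))) x := by
  have hG := hw.bell_density hΨ
  have hW := hG.bell_avg hL
  have e : R = fun x => prim (avg (density Ψ δ σ R)) (x + 1 / 2)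
      - prim (avg (density Ψ δ σ R)) (x - 1 / 2) := by
    conv_lhs => rw [hw.eq_avg]
    exact funext hW.avg_eq
  have h1 := (hW.hasDerivAt_prim (x + 1 / 2)).comp_add_const x (1 / 2)
  have h2 := (hW.hasDerivAt_prim (x - 1 / 2)).comp_sub_const x (1 / 2)
  have h3 := h1.sub h2
  have e2 : avg (density Ψ δ σ R) (x + 1 / 2) - avg (density Ψ δ σ R) (x - 1 / 2)
      = -(2 * prim (density Ψ δ σ R) x) +
      (prim (density Ψ δ σ R) (1 + x) - prim (density Ψ δ σ R) (1 - x)) := by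
    rw [hG.avg_eq, hG.avg_eq, show x + 1 / 2 + 1 / 2 = 1 + x by ring,
      show x + 1 / 2 - 1 / 2 = x by ring, show x - 1 / 2 + 1 / 2 = x by ring,
      show x - 1 / 2 - 1 / 2 = -(1 - x) by ring, hG.prim_neg]
    ring
  rw [e2] at h3
  exact h3.congr_of_eventuallyEq (Filter.Eventually.of_forall fun y => congrFun e y)

end Wave

/-! ### Approximate first integral in the bulk -/

section Bulk

variable {Ψ : ℝ → ℝ} {μ L δ σ : ℝ} {R : ℝ → ℝ}

/-- The interaction with the neighbouring pulses is negligible against the local force. -/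
theorem IsWave.interaction_bounds (hw : IsWave Ψ L δ σ R) (hs : IsSmall Ψ δ σ R)
    (hΨ : IsForce Ψ μ) (hL : 2 < L) {x : ℝ} (h0 : 0 ≤ x) (h1 : x ≤ 1 / 4) :
    0 ≤ prim (density Ψ δ σ R) (1 + x) - prim (density Ψ δ σ R) (1 - x) ∧
    prim (density Ψ δ σ R) (1 + x) - prim (density Ψ δ σ R) (1 - x)
      ≤ 2 * δ * prim (density Ψ δ σ R) x := by
  have hG := hw.bell_density hΨ
  have hδ := hw.delta_pos
  refine ⟨sub_nonneg.2 (hG.monotone_prim (by linarith)), ?_⟩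
  have a1 := hG.prim_sub_le (a := 1 - x) (b := 1 + x) (by linarith) (by linarith) (by linarith)
  have a2 := hG.le_of_le (x := 3 / 4) (y := 1 - x) (by norm_num) (by linarith) (by linarith)
  have a3 := hG.le_of_le (x := x) (y := 1 / 4) h0 h1 (by linarith)
  have a4 := hG.mul_le_prim h0 (by linarith)
  have a5 := hs.outer
  calc _ ≤ (1 + x - (1 - x)) * density Ψ δ σ R (1 - x) := a1
    _ ≤ (1 + x - (1 - x)) * (δ * density Ψ δ σ R x) := by
        refine mul_le_mul_of_nonneg_left ?_ (by linarith)
        exact a2.trans (a5.trans (mul_le_mul_of_nonneg_left a3 hδ.le))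
    _ = 2 * δ * (x * density Ψ δ σ R x) := by ring
    _ ≤ _ := by gcongr

theorem IsWave.apex_sub_bounds (hw : IsWave Ψ L δ σ R) (hs : IsSmall Ψ δ σ R)
    (hΨ : IsForce Ψ μ) (hL : 2 < L) {x : ℝ} (h0 : 0 ≤ x) (h1 : x ≤ 1 / 4) :
    0 ≤ R 0 - R x ∧ R 0 - R x ≤ 2 * x := by
  have hG := hw.bell_density hΨ
  refine ⟨sub_nonneg.2 (hw.bell.le_of_le le_rfl h0 (by linarith)), ?_⟩
  have hd : ∀ t, HasDerivAt (fun t => R t + 2 * t) _ t := fun t =>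
    (hw.hasDerivAt hΨ hL t).add ((hasDerivAt_id t).const_mul 2)
  have hm : MonotoneOn (fun t => R t + 2 * t) (Icc 0 (1 / 4)) := by
    refine monotoneOn_of_deriv_nonneg (convex_Icc _ _)
      (fun t _ => (hd t).continuousAt.continuousWithinAt)
      (fun t _ => (hd t).differentiableAt.differentiableWithinAt) fun t ht => ?_
    rw [interior_Icc] at ht
    rw [(hd t).deriv]
    have b1 := hw.interaction_bounds hs hΨ hL ht.1.le ht.2.le
    have b2 := hG.monotone_prim ht.2.le
    have b3 := hw.prim_quarter_le hΨ hL
    linarith [b1.1]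
  have := hm (left_mem_Icc.2 (by norm_num)) ⟨h0, h1⟩ h0
  simp only [mul_zero, add_zero] at this
  linarith

/-- The amplitude `A` of the exponential approximation `A exp(R / δ)` of the density. -/
noncomputable def amplitude (μ δ σ : ℝ) (R : ℝ → ℝ) : ℝ := (R 0 / δ) ^ μ / σ

theorem IsWave.amplitude_pos (hw : IsWave Ψ L δ σ R) : 0 < amplitude μ δ σ R := by
  have := (abs_le.1 (hw.tent 0 le_rfl zero_le_one)).1
  exact div_pos (Real.rpow_pos_of_pos (div_pos (by linarith) hw.delta_pos) μ) hw.sigma_pos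

theorem IsForce.exists_density_approx (hΨ : IsForce Ψ μ) :
    ∃ C : ℝ, 0 < C ∧ ∀ {L δ σ : ℝ} {R : ℝ → ℝ}, IsWave Ψ L δ σ R → IsSmall Ψ δ σ R → 2 < L →
      ∀ x, 0 ≤ x → x ≤ 1 / 4 →
      |density Ψ δ σ R x - amplitude μ δ σ R * Real.exp (R x / δ)|
        ≤ C * (δ + (R 0 - R x)) * (amplitude μ δ σ R * Real.exp (R x / δ)) := by
  obtain ⟨C, hC, h⟩ := hΨ.exists_abs_sub_rpow_le
  refine ⟨C, hC, fun {L δ σ R} hw hs hL x h0 h1 => ?_⟩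
  have hσ := hw.sigma_pos
  have t := (abs_le.1 (hw.tent x h0 (by linarith))).1
  have := h δ (R 0) (R x) hw.delta_pos hs.delta_le (by linarith)
    (hw.bell.le_of_le le_rfl h0 (by linarith)) hw.apex_le
  have hE := Real.exp_pos (R x / δ)
  unfold density amplitude force
  rw [show Ψ (R x / δ) * Real.exp (R x / δ) / σ - (R 0 / δ) ^ μ / σ * Real.exp (R x / δ)
    = (Ψ (R x / δ) - (R 0 / δ) ^ μ) * (Real.exp (R x / δ) / σ) by ring, abs_mul,
    abs_of_pos (div_pos hE hσ)]
  calc _ ≤ (C * (δ + (R 0 - R x)) * (R 0 / δ) ^ μ) * (Real.exp (R x / δ) / σ) := by gcongr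
    _ = _ := by ring

/-- Approximate conservation of `K² + δ A exp(R / δ)`, where `K` is the primitive of the
density. For the exact exponential force on the line this is a first integral. -/
theorem IsForce.exists_first_integral_approx (hΨ : IsForce Ψ μ) :
    ∃ C : ℝ, 0 < C ∧ ∀ {L δ σ : ℝ} {R : ℝ → ℝ}, IsWave Ψ L δ σ R → IsSmall Ψ δ σ R → 2 < L →
      ∀ x, 0 ≤ x → x ≤ 1 / 4 →
      |(prim (density Ψ δ σ R) (1 / 4) ^ 2
            + δ * (amplitude μ δ σ R * Real.exp (R (1 / 4) / δ)))
          - (prim (density Ψ δ σ R) x ^ 2 + δ * (amplitude μ δ σ R * Real.exp (R x / δ)))|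
        ≤ C * (2 * δ + (R 0 - R x)) * (δ * (amplitude μ δ σ R * Real.exp (R x / δ))) := by
  obtain ⟨C, hC, h⟩ := hΨ.exists_density_approx
  refine ⟨2 * (C + 1), by positivity, fun {L δ σ R} hw hs hL x h0 h1 => ?_⟩
  have hδ := hw.delta_pos
  have hG := hw.bell_density hΨ
  set A := amplitude μ δ σ R with hA
  have A0 : 0 < A := hw.amplitude_pos
  set G := density Ψ δ σ R with hGdef
  set K := prim G with hK
  set e : ℝ → ℝ := fun x => K (1 + x) - K (1 - x) with he
  set E : ℝ → ℝ := fun x => Real.exp (R x / δ) with hE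
  have E0 : ∀ t, 0 < E t := fun t => Real.exp_pos _
  have dR : ∀ t, HasDerivAt R (-(2 * K t) + e t) t := fun t => hw.hasDerivAt hΨ hL t
  have dE : ∀ t, HasDerivAt E (E t * ((-(2 * K t) + e t) / δ)) t := fun t =>
    ((dR t).div_const δ).exp
  have dK : ∀ t, HasDerivAt K (G t) t := hG.hasDerivAt_prim
  set J : ℝ → ℝ := fun t => K t ^ 2 + δ * (A * E t) with hJ
  -- `B` is chosen so that `-B'` dominates `|J'|` with the weight `K`, which vanishes at `0`.
  set B : ℝ → ℝ := fun t => 2 * (C + 1) * (2 * δ + (R 0 - R t)) * (δ * (A * E t)) with hB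
  have dJ : ∀ t, HasDerivAt J (2 * K t * (G t - A * E t) + A * E t * e t) t := by
    intro t
    have := ((dK t).pow 2).add (((dE t).const_mul A).const_mul δ)
    refine this.congr_deriv ?_
    simp only [Nat.cast_ofNat]
    field_simp
    ring
  have dB : ∀ t, HasDerivAt B
      (-(2 * (C + 1) * (A * E t) * (2 * K t - e t) * (δ + (R 0 - R t)))) t := by
    intro t
    have := ((((dR t).const_sub (R 0)).const_add (2 * δ)).const_mul (2 * (C + 1))).mul
      (((dE t).const_mul A).const_mul δ)
    refine this.congr_deriv ?_
    field_simp
    ring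
  have key : ∀ t ∈ Ioo (0 : ℝ) (1 / 4), |2 * K t * (G t - A * E t) + A * E t * e t|
      ≤ 2 * (C + 1) * (A * E t) * (2 * K t - e t) * (δ + (R 0 - R t)) := by
    intro t ht
    have k1 := h hw hs hL t ht.1.le ht.2.le
    have k2 := hw.interaction_bounds hs hΨ hL ht.1.le ht.2.le
    have k3 := (hw.apex_sub_bounds hs hΨ hL ht.1.le ht.2.le).1
    have k4 : 0 ≤ K t := hG.prim_nonneg ht.1.le
    have k5 := E0 t
    have k6 : 0 ≤ e t := k2.1
    have k7 : e t ≤ 2 * δ * K t := k2.2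
    have k8 : K t ≤ 2 * K t - e t := by nlinarith [hs.delta_le]
    calc |2 * K t * (G t - A * E t) + A * E t * e t|
        ≤ 2 * K t * |G t - A * E t| + A * E t * e t := by
          refine (abs_add_le _ _).trans (le_of_eq ?_)
          rw [abs_mul, abs_of_nonneg (by positivity : 0 ≤ 2 * K t),
            abs_of_nonneg (by positivity : 0 ≤ A * E t * e t)]
      _ ≤ 2 * K t * (C * (δ + (R 0 - R t)) * (A * E t)) + A * E t * (2 * δ * K t) := by gcongr
      _ = 2 * (A * E t) * K t * (C * (δ + (R 0 - R t)) + δ) := by ring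
      _ ≤ 2 * (A * E t) * K t * ((C + 1) * (δ + (R 0 - R t))) := by
          gcongr; linarith
      _ = 2 * (C + 1) * (A * E t) * K t * (δ + (R 0 - R t)) := by ring
      _ ≤ _ := by gcongr
  have anti : AntitoneOn (fun t => J t + B t) (Icc 0 (1 / 4)) := by
    have d : ∀ t, HasDerivAt (fun t => J t + B t) _ t := fun t => (dJ t).add (dB t)
    refine antitoneOn_of_deriv_nonpos (convex_Icc _ _)
      (fun t _ => (d t).continuousAt.continuousWithinAt)
      (fun t _ => (d t).differentiableAt.differentiableWithinAt) fun t ht => ?_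
    rw [interior_Icc] at ht
    rw [(d t).deriv]
    linarith [(abs_le.1 (key t ht)).2]
  have mono : MonotoneOn (fun t => J t - B t) (Icc 0 (1 / 4)) := by
    have d : ∀ t, HasDerivAt (fun t => J t - B t) _ t := fun t => (dJ t).sub (dB t)
    refine monotoneOn_of_deriv_nonneg (convex_Icc _ _)
      (fun t _ => (d t).continuousAt.continuousWithinAt)
      (fun t _ => (d t).differentiableAt.differentiableWithinAt) fun t ht => ?_
    rw [interior_Icc] at ht
    rw [(d t).deriv]
    linarith [(abs_le.1 (key t ht)).1]
  have B0 : 0 ≤ B (1 / 4) := by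
    have k3 := (hw.apex_sub_bounds hs hΨ hL (x := 1 / 4) (by norm_num) le_rfl).1
    have := E0 (1 / 4)
    simp only [hB]
    positivity
  have m1 := anti (⟨h0, h1⟩ : x ∈ Icc (0 : ℝ) (1 / 4)) (right_mem_Icc.2 (by norm_num)) h1
  have m2 := mono (⟨h0, h1⟩ : x ∈ Icc (0 : ℝ) (1 / 4)) (right_mem_Icc.2 (by norm_num)) h1
  simp only at m1 m2
  change |J (1 / 4) - J x| ≤ B x
  rw [abs_le]
  constructor <;> linarith

/-- In the bulk, `(m/2)² - K²` agrees with `δ A exp(R / δ)` up to a relative error of order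
`δ + (R(0) - R)`. -/
theorem IsForce.exists_energy_gap_approx (hΨ : IsForce Ψ μ) (hL : 2 < L) :
    ∃ C : ℝ, 0 < C ∧ ∀ {δ σ : ℝ} {R : ℝ → ℝ}, IsWave Ψ L δ σ R → IsSmall Ψ δ σ R →
      ∀ x, 0 ≤ x → x ≤ 1 / 8 →
      |(mass Ψ L δ σ R / 2) ^ 2 - prim (density Ψ δ σ R) x ^ 2
          - δ * (amplitude μ δ σ R * Real.exp (R x / δ))|
        ≤ C * (δ + (R 0 - R x)) * (δ * (amplitude μ δ σ R * Real.exp (R x / δ))) := by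
  obtain ⟨C₁, hC₁, h₁⟩ := hΨ.exists_density_approx
  obtain ⟨C₂, hC₂, h₂⟩ := hΨ.exists_first_integral_approx
  refine ⟨(2 + 8 * L) * L * (1 + 2 * C₁) + 1 + 2 * C₂, by positivity,
    fun {δ σ R} hw hs x h0 h1 => ?_⟩
  have hδ := hw.delta_pos
  have hδ2 := hs.delta_le
  have hG := hw.bell_density hΨ
  have a1 := h₁ hw hs hL x h0 (by linarith)
  have a2 := h₂ hw hs hL x h0 (by linarith)
  have a3 := hw.apex_sub_bounds hs hΨ hL h0 (by linarith)
  have a4 := hw.mass_le hΨ hL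
  have a5 := hw.half_le_mass hΨ hL
  have a6 := hG.prim_sub_le (a := 1 / 4) (b := L) (by norm_num) (by linarith) le_rfl
  have a7 := hG.le_of_le h0 h1 (by linarith)
  have a8 := hw.bell.le_of_le h0 h1 (by linarith)
  have a9 := hs.inner
  have a10 := hs.exp_le
  have a11 := hG.monotone_prim (by linarith : (1 / 4 : ℝ) ≤ L)
  have a12 := hG.prim_nonneg (by norm_num : (0 : ℝ) ≤ 1 / 4)
  have mdef : mass Ψ L δ σ R = 2 * prim (density Ψ δ σ R) L := rfl
  have A0 : 0 < amplitude μ δ σ R := hw.amplitude_pos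
  have E1 : Real.exp (R (1 / 8) / δ) ≤ Real.exp (R x / δ) := by gcongr
  have E0 := Real.exp_pos (R x / δ)
  have g0 := hG.nonneg (1 / 4)
  set A := amplitude μ δ σ R
  set G := density Ψ δ σ R
  set K := prim G
  set m := mass Ψ L δ σ R
  set ρ := R 0 - R x
  set Y := A * Real.exp (R x / δ) with hY
  have Y0 : 0 < Y := by positivity
  -- the tail of the mass beyond `1/4`
  have b1 : 0 ≤ (m / 2) ^ 2 - K (1 / 4) ^ 2 := by nlinarith
  have b2 : (m / 2) ^ 2 - K (1 / 4) ^ 2 ≤ (2 + 8 * L) * L * (1 + 2 * C₁) * (δ + ρ) * (δ * Y) := by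
    have c1 : m / 2 - K (1 / 4) ≤ L * G (1 / 4) := by nlinarith
    have c2 : G (1 / 4) ≤ δ ^ 2 * G x := a9.trans (by gcongr)
    have c3 : G x ≤ (1 + 2 * C₁) * Y := by
      have := (abs_le.1 a1).2
      have : C₁ * (δ + ρ) * Y ≤ C₁ * 2 * Y := by gcongr; linarith
      linarith
    calc (m / 2) ^ 2 - K (1 / 4) ^ 2 = (m / 2 + K (1 / 4)) * (m / 2 - K (1 / 4)) := by ring
      _ ≤ (2 + 8 * L) * (L * (δ ^ 2 * ((1 + 2 * C₁) * Y))) := by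
          refine mul_le_mul (by linarith) (c1.trans ?_) (by linarith) (by linarith)
          refine mul_le_mul_of_nonneg_left (c2.trans ?_) (by linarith)
          gcongr
      _ = (2 + 8 * L) * L * (1 + 2 * C₁) * δ * (δ * Y) := by ring
      _ ≤ _ := by gcongr; linarith [a3.1]
  have b3 : 0 ≤ δ * (A * Real.exp (R (1 / 4) / δ)) := by positivity
  have b4 : δ * (A * Real.exp (R (1 / 4) / δ)) ≤ (δ + ρ) * (δ * Y) := by
    calc δ * (A * Real.exp (R (1 / 4) / δ)) ≤ δ * (A * (δ * Real.exp (R x / δ))) := by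
          gcongr; exact a10.trans (by gcongr)
      _ = δ * (δ * Y) := by rw [hY]; ring
      _ ≤ _ := by gcongr; linarith [a3.1]
  have b5 : C₂ * (2 * δ + ρ) * (δ * Y) ≤ 2 * C₂ * (δ + ρ) * (δ * Y) := by
    rw [show 2 * C₂ * (δ + ρ) * (δ * Y) = C₂ * (2 * (δ + ρ)) * (δ * Y) by ring]
    gcongr; linarith [a3.1]
  have b6 := abs_le.1 a2
  rw [abs_le, show ((2 + 8 * L) * L * (1 + 2 * C₁) + 1 + 2 * C₂) * (δ + ρ) * (δ * Y)
    = (2 + 8 * L) * L * (1 + 2 * C₁) * (δ + ρ) * (δ * Y) + (δ + ρ) * (δ * Y)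
      + 2 * C₂ * (δ + ρ) * (δ * Y) by ring]
  have b7 : 0 ≤ (δ + ρ) * (δ * Y) := b3.trans b4
  have b8 := b1.trans b2
  constructor <;> linarith [b6.1, b6.2]

/-- The logistic equation with a small relative defect: `δ K' ≈ (m/2)² - K²` near the origin. -/
theorem IsForce.exists_logistic (hΨ : IsForce Ψ μ) (hL : 2 < L) :
    ∃ C ε : ℝ, 0 < C ∧ 0 < ε ∧ ε ≤ 1 / 8 ∧ ∀ {δ σ : ℝ} {R : ℝ → ℝ}, IsWave Ψ L δ σ R →
      IsSmall Ψ δ σ R → δ ≤ ε → ∀ x, 0 ≤ x → x ≤ ε →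
      C * (δ + x) ≤ 1 / 2 ∧
      0 < (mass Ψ L δ σ R / 2) ^ 2 - prim (density Ψ δ σ R) x ^ 2 ∧
      |δ * density Ψ δ σ R x - ((mass Ψ L δ σ R / 2) ^ 2 - prim (density Ψ δ σ R) x ^ 2)|
        ≤ C * (δ + x) * ((mass Ψ L δ σ R / 2) ^ 2 - prim (density Ψ δ σ R) x ^ 2) := by
  obtain ⟨C₁, hC₁, h₁⟩ := hΨ.exists_density_approx
  obtain ⟨C₃, hC₃, h₃⟩ := hΨ.exists_energy_gap_approx hL
  have hC : 0 < 4 * (C₁ + C₃) := by positivity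
  refine ⟨4 * (C₁ + C₃), min (1 / 8) (1 / (4 * (4 * (C₁ + C₃)))), hC, by positivity,
    min_le_left _ _, fun {δ σ R} hw hs hδε x h0 h1 => ?_⟩
  have hδ := hw.delta_pos
  have x8 : x ≤ 1 / 8 := h1.trans (min_le_left _ _)
  have r1 := h1.trans (min_le_right _ _)
  have r2 := hδε.trans (min_le_right _ _)
  rw [le_div_iff₀ (by positivity)] at r1 r2
  have small : 4 * (C₁ + C₃) * (δ + x) ≤ 1 / 2 := by linarith
  refine ⟨small, ?_⟩
  have a1 := h₁ hw hs hL x h0 (by linarith)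
  have a2 := h₃ hw hs x h0 x8
  have a3 := hw.apex_sub_bounds hs hΨ hL h0 (by linarith)
  have A0 : 0 < amplitude μ δ σ R := hw.amplitude_pos
  set G := density Ψ δ σ R
  set q := (mass Ψ L δ σ R / 2) ^ 2 - prim G x ^ 2
  set ρ := R 0 - R x
  set Y := amplitude μ δ σ R * Real.exp (R x / δ) with hY
  have Y0 : 0 < δ * Y := by have := Real.exp_pos (R x / δ); positivity
  have ρ2 : δ + ρ ≤ 2 * (δ + x) := by linarith
  have ρ0 : 0 ≤ δ + ρ := by linarith
  have d0 : 0 ≤ δ + x := by linarith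
  have b1 : C₃ * (δ + ρ) ≤ 1 / 2 := by nlinarith
  have b2 : C₃ * (δ + ρ) * (δ * Y) ≤ 1 / 2 * (δ * Y) := by gcongr
  have b3 := abs_le.1 a2
  have b4 : δ * Y ≤ 2 * q := by linarith [b3.1]
  refine ⟨by linarith, ?_⟩
  have b5 : |δ * G x - δ * Y| ≤ C₁ * (δ + ρ) * (δ * Y) := by
    rw [← mul_sub, abs_mul, abs_of_pos hδ]
    calc δ * |G x - Y| ≤ δ * (C₁ * (δ + ρ) * Y) := by gcongr
      _ = _ := by ring
  calc |δ * G x - q| = |(δ * G x - δ * Y) - (q - δ * Y)| := by congr 1; ring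
    _ ≤ |δ * G x - δ * Y| + |q - δ * Y| := abs_sub _ _
    _ ≤ C₁ * (δ + ρ) * (δ * Y) + C₃ * (δ + ρ) * (δ * Y) := add_le_add b5 a2
    _ = (C₁ + C₃) * (δ + ρ) * (δ * Y) := by ring
    _ ≤ (C₁ + C₃) * (2 * (δ + x)) * (2 * q) := by gcongr
    _ = _ := by ring

end Bulk

/-! ### The logistic phase -/

/-- Near the origin `K` is a logistic profile `m (sigmoid u - 1/2)` whose phase `u` is close to
`m x / δ`. -/
theorem IsForce.exists_phase {Ψ : ℝ → ℝ} {μ L : ℝ} (hΨ : IsForce Ψ μ) (hL : 2 < L) :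
    ∃ C ε : ℝ, 0 < C ∧ 0 < ε ∧ ε ≤ 1 / 8 ∧ ∀ {δ σ : ℝ} {R : ℝ → ℝ}, IsWave Ψ L δ σ R →
      IsSmall Ψ δ σ R → δ ≤ ε → ∀ x, 0 ≤ x → x ≤ ε →
      ∃ u : ℝ, prim (density Ψ δ σ R) x = mass Ψ L δ σ R * (Real.sigmoid u - 1 / 2) ∧
        mass Ψ L δ σ R * x / (2 * δ) ≤ u ∧
        |u - mass Ψ L δ σ R * x / δ| ≤ mass Ψ L δ σ R * C * (x + x ^ 2 / δ) := by
  obtain ⟨C, ε, hC, hε, hε8, h⟩ := hΨ.exists_logistic hL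
  refine ⟨C, ε, hC, hε, hε8, fun {δ σ R} hw hs hδε x h0 h1 => ?_⟩
  have hδ := hw.delta_pos
  have hG := hw.bell_density hΨ
  have m0 : 0 < mass Ψ L δ σ R := by linarith [hw.half_le_mass hΨ hL]
  have H := fun t (ht : t ∈ Icc 0 ε) => h hw hs hδε t ht.1 ht.2
  have K0 := fun t (ht : t ∈ Icc 0 ε) => hG.prim_nonneg ht.1
  have dK := hG.hasDerivAt_prim
  have Kz := prim_zero (density Ψ δ σ R)
  set G := density Ψ δ σ R
  set K := prim G
  set m := mass Ψ L δ σ R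
  have up : ∀ t ∈ Icc 0 ε, 0 < m / 2 - K t := fun t ht => by
    have h1 := (H t ht).2.1
    have h2 := K0 t ht
    rw [sq_sub_sq] at h1
    exact pos_of_mul_pos_right h1 (by positivity)
  have lo : ∀ t ∈ Icc 0 ε, 0 < m / 2 + K t := fun t ht => by
    have := K0 t ht
    positivity
  -- The phase solves `K = m (sigmoid u - 1/2)`, so that `u' = m K' / ((m/2)² - K²)`.
  set u : ℝ → ℝ := fun t => Real.log (m / 2 + K t) - Real.log (m / 2 - K t) with hu
  have du : ∀ t ∈ Icc 0 ε, HasDerivAt u (m * G t / ((m / 2) ^ 2 - K t ^ 2)) t := by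
    intro t ht
    have p1 := up t ht
    have p2 := lo t ht
    have := (((dK t).const_add (m / 2)).log p2.ne').sub (((dK t).const_sub (m / 2)).log p1.ne')
    refine this.congr_deriv ?_
    rw [div_sub_div _ _ p2.ne' p1.ne', sq_sub_sq]
    congr 1
    ring
  have u0 : u 0 = 0 := by simp [hu, Kz]
  -- the derivative of the phase is `(m / δ) (1 + O(δ + t))`
  have slope : ∀ t ∈ Icc 0 ε,
      |m * G t / ((m / 2) ^ 2 - K t ^ 2) - m / δ| ≤ m / δ * (C * (δ + t)) := by
    intro t ht
    obtain ⟨-, q0, hq⟩ := H t ht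
    set q := (m / 2) ^ 2 - K t ^ 2
    have : m * G t / q - m / δ = m / δ * ((δ * G t - q) / q) := by field_simp
    rw [this, abs_mul, abs_of_pos (by positivity : 0 < m / δ), abs_div, abs_of_pos q0]
    gcongr
    rwa [div_le_iff₀ q0]
  have hx : x ∈ Icc 0 ε := ⟨h0, h1⟩
  have h00 : (0 : ℝ) ∈ Icc 0 ε := left_mem_Icc.2 hε.le
  refine ⟨u x, ?_, ?_, ?_⟩
  · have p1 := up x hx
    have p2 := lo x hx
    have : Real.exp (-(u x)) = (m / 2 - K x) / (m / 2 + K x) := by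
      rw [hu, neg_sub, Real.exp_sub, Real.exp_log p1, Real.exp_log p2]
    have e : 1 + (m / 2 - K x) / (m / 2 + K x) = m / (m / 2 + K x) := by
      rw [eq_div_iff p2.ne', add_mul, div_mul_cancel₀ _ p2.ne']
      ring
    rw [Real.sigmoid_def, this, e, inv_div]
    field_simp
    ring
  · have d : ∀ t ∈ Icc 0 ε, HasDerivAt (fun t => u t - m / (2 * δ) * t) _ t := fun t ht =>
      (du t ht).sub ((hasDerivAt_id t).const_mul (m / (2 * δ)))
    have mono : MonotoneOn (fun t => u t - m / (2 * δ) * t) (Icc 0 ε) := by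
      refine monotoneOn_of_deriv_nonneg (convex_Icc _ _)
        (fun t ht => (d t ht).continuousAt.continuousWithinAt)
        (fun t ht => (d t (interior_subset ht)).differentiableAt.differentiableWithinAt)
        fun t ht => ?_
      have ht' := interior_subset ht
      rw [(d t ht').deriv]
      have s1 := (abs_le.1 (slope t ht')).1
      have s2 : m / δ * (C * (δ + t)) ≤ m / δ * (1 / 2) := by
        gcongr; exact (H t ht').1
      have s3 : m / (2 * δ) = m / δ * (1 / 2) := by field_simp
      rw [s3]
      linarith
    have := mono h00 hx h0
    simp only [u0, mul_zero, sub_zero] at this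
    have e : m * x / (2 * δ) = m / (2 * δ) * x := by ring
    linarith
  · set w : ℝ → ℝ := fun t => m / δ * (C * (δ * t + t ^ 2 / 2)) with hw'
    have dw : ∀ t, HasDerivAt w (m / δ * (C * (δ + t))) t := by
      intro t
      have := ((((hasDerivAt_id t).const_mul δ).add
        (((hasDerivAt_id t).pow 2).div_const 2)).const_mul C).const_mul (m / δ)
      refine this.congr_deriv ?_
      simp
    have dl : ∀ t ∈ Icc 0 ε, HasDerivAt (fun t => u t - m / δ * t)
        (m * G t / ((m / 2) ^ 2 - K t ^ 2) - m / δ) t := fun t ht =>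
      ((du t ht).sub ((hasDerivAt_id t).const_mul (m / δ))).congr_deriv (by simp)
    have mono : MonotoneOn (fun t => (u t - m / δ * t) + w t) (Icc 0 ε) := by
      have d : ∀ t ∈ Icc 0 ε, HasDerivAt (fun t => (u t - m / δ * t) + w t) _ t := fun t ht =>
        (dl t ht).add (dw t)
      refine monotoneOn_of_deriv_nonneg (convex_Icc _ _)
        (fun t ht => (d t ht).continuousAt.continuousWithinAt)
        (fun t ht => (d t (interior_subset ht)).differentiableAt.differentiableWithinAt)
        fun t ht => ?_
      have ht' := interior_subset ht
      rw [(d t ht').deriv]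
      linarith [(abs_le.1 (slope t ht')).1]
    have anti : AntitoneOn (fun t => (u t - m / δ * t) - w t) (Icc 0 ε) := by
      have d : ∀ t ∈ Icc 0 ε, HasDerivAt (fun t => (u t - m / δ * t) - w t) _ t := fun t ht =>
        (dl t ht).sub (dw t)
      refine antitoneOn_of_deriv_nonpos (convex_Icc _ _)
        (fun t ht => (d t ht).continuousAt.continuousWithinAt)
        (fun t ht => (d t (interior_subset ht)).differentiableAt.differentiableWithinAt)
        fun t ht => ?_
      have ht' := interior_subset ht
      rw [(d t ht').deriv]
      linarith [(abs_le.1 (slope t ht')).2]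
    have e1 := mono h00 hx h0
    have e2 := anti h00 hx h0
    have w0 : w 0 = 0 := by simp [hw']
    simp only [u0, w0, mul_zero, sub_zero, add_zero] at e1 e2
    have e3 : w x ≤ m * C * (x + x ^ 2 / δ) := by
      have : w x = m * C * (x + x ^ 2 / δ / 2) := by simp only [hw']; field_simp
      rw [this]
      have : 0 ≤ x ^ 2 / δ := by positivity
      exact mul_le_mul_of_nonneg_left (by linarith) (by positivity)
    have e4 : m * x / δ = m / δ * x := by ring
    rw [e4, abs_le]
    constructor <;> linarith

theorem one_sub_sigmoid_le (u : ℝ) : 1 - Real.sigmoid u ≤ Real.exp (-u) := by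
  rw [← Real.sigmoid_neg, ← Real.sigmoid_mul_rexp_neg]
  exact mul_le_of_le_one_left (Real.exp_pos _).le (Real.sigmoid_le_one u)

theorem abs_sigmoid_sub_le {a b c : ℝ} (ha : c ≤ a) (hb : c ≤ b) :
    |Real.sigmoid a - Real.sigmoid b| ≤ Real.exp (-c) * |a - b| := by
  refine (convex_Ici c).norm_image_sub_le_of_norm_hasDerivWithin_le
    (fun x _ => (Real.hasDerivAt_sigmoid x).hasDerivWithinAt) (fun x hx => ?_) hb ha
  have h1 := Real.sigmoid_pos x
  have h2 := Real.sigmoid_lt_one x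
  rw [Real.norm_eq_abs, abs_of_nonneg (mul_nonneg h1.le (by linarith))]
  calc Real.sigmoid x * (1 - Real.sigmoid x) ≤ 1 * Real.exp (-x) :=
        mul_le_mul h2.le (one_sub_sigmoid_le x) (by linarith) zero_le_one
    _ ≤ Real.exp (-c) := by
        rw [one_mul]; exact Real.exp_le_exp.2 (neg_le_neg hx)

/-! ### The mass of the density -/

/-- The local description of the primitive `K` of a density `G` with mass `m`: the logistic
equation and the logistic shape with phase close to `m x / δ` hold on `[0, ε]`, and the mass outside
of `[-ε, ε]` is negligible. -/
structure IsProfile (C ε L δ m : ℝ) (G K : ℝ → ℝ) : Prop where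
  logistic : ∀ x, 0 ≤ x → x ≤ ε →
    |δ * G x - ((m / 2) ^ 2 - K x ^ 2)| ≤ C * (δ + x) * ((m / 2) ^ 2 - K x ^ 2)
  phase : ∀ x, 0 ≤ x → x ≤ ε → ∃ u : ℝ, K x = m * (Real.sigmoid u - 1 / 2) ∧
    m * x / (2 * δ) ≤ u ∧ |u - m * x / δ| ≤ m * C * (x + x ^ 2 / δ)
  decay : ∀ x, 0 ≤ x → x ≤ ε → 0 ≤ m / 2 - K x ∧ m / 2 - K x ≤ m * Real.exp (-(x / (4 * δ)))
  far : ∀ x, ε ≤ x → x ≤ 2 * L - ε → |K x - m / 2| ≤ C * δ ^ 2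

theorem IsForce.exists_isProfile {Ψ : ℝ → ℝ} {μ L : ℝ} (hΨ : IsForce Ψ μ) (hL : 2 < L) :
    ∃ C ε : ℝ, 0 < C ∧ 0 < ε ∧ ε ≤ 1 / 8 ∧ ∀ {δ σ : ℝ} {R : ℝ → ℝ}, IsWave Ψ L δ σ R →
      IsSmall Ψ δ σ R → δ ≤ ε →
      IsProfile C ε L δ (mass Ψ L δ σ R) (density Ψ δ σ R) (prim (density Ψ δ σ R)) := by
  obtain ⟨C₁, ε₁, hC₁, hε₁, hε₁8, h₁⟩ := hΨ.exists_logistic hL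
  obtain ⟨C₂, ε₂, hC₂, hε₂, hε₂8, h₂⟩ := hΨ.exists_phase hL
  set ε := min ε₁ ε₂ with hεdef
  have hε : 0 < ε := by positivity
  set C₃ := (2 + 8 * L) * ((2 : ℕ).factorial / (ε / 4) ^ 2) with hC₃
  have hC₃0 : 0 < C₃ := by positivity
  refine ⟨C₁ + C₂ + C₃, ε, by positivity, hε, (min_le_left _ _).trans hε₁8,
    fun {δ σ R} hw hs hδε => ?_⟩
  have hδ := hw.delta_pos
  have hG := hw.bell_density hΨ
  have mlo := hw.half_le_mass hΨ hL
  have mhi := hw.mass_le hΨ hL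
  have l1 : ε ≤ ε₁ := min_le_left _ _
  have l2 : ε ≤ ε₂ := min_le_right _ _
  have mdef : mass Ψ L δ σ R = 2 * prim (density Ψ δ σ R) L := rfl
  have H₁ := fun x h0 (h1 : x ≤ ε) => h₁ hw hs (hδε.trans l1) x h0 (h1.trans l1)
  have H₂ := fun x h0 (h1 : x ≤ ε) => h₂ hw hs (hδε.trans l2) x h0 (h1.trans l2)
  set G := density Ψ δ σ R
  set K := prim G
  set m := mass Ψ L δ σ R
  have m0 : 0 < m := by linarith
  have up : ∀ x, x ≤ L → 0 ≤ m / 2 - K x := fun x hx => by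
    linarith [hG.monotone_prim hx]
  have decay : ∀ x, 0 ≤ x → x ≤ ε →
      0 ≤ m / 2 - K x ∧ m / 2 - K x ≤ m * Real.exp (-(x / (4 * δ))) := by
    intro x h0 h1
    refine ⟨up x (by linarith), ?_⟩
    obtain ⟨u, hu1, hu2, -⟩ := H₂ x h0 h1
    have e : m / 2 - K x = m * (1 - Real.sigmoid u) := by rw [hu1]; ring
    rw [e]
    refine mul_le_mul_of_nonneg_left ((one_sub_sigmoid_le u).trans ?_) m0.le
    refine Real.exp_le_exp.2 (neg_le_neg (le_trans ?_ hu2))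
    rw [div_le_div_iff₀ (by positivity) (by positivity)]
    have := mul_nonneg h0 hδ.le
    nlinarith
  have far1 : ∀ x, ε ≤ x → x ≤ L → m / 2 - K x ≤ C₃ * δ ^ 2 := by
    intro x h0 h1
    have := (decay ε hε.le le_rfl).2
    calc m / 2 - K x ≤ m / 2 - K ε := by linarith [hG.monotone_prim h0]
      _ ≤ m * Real.exp (-(ε / 4 / δ)) := by rwa [div_div]
      _ ≤ (2 + 8 * L) * ((2 : ℕ).factorial / (ε / 4) ^ 2 * δ ^ 2) := by
          gcongr
          exact exp_neg_div_le (by positivity) hδ 2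
      _ = C₃ * δ ^ 2 := by rw [hC₃]; ring
  refine ⟨fun x h0 h1 => ?_, fun x h0 h1 => ?_, decay, fun x h0 h1 => ?_⟩
  · obtain ⟨-, q0, hq⟩ := H₁ x h0 h1
    refine hq.trans ?_
    gcongr
    linarith
  · obtain ⟨u, hu1, hu2, hu3⟩ := H₂ x h0 h1
    refine ⟨u, hu1, hu2, hu3.trans ?_⟩
    gcongr
    linarith
  · have le3 : C₃ * δ ^ 2 ≤ (C₁ + C₂ + C₃) * δ ^ 2 := by gcongr; linarith
    rcases le_total x L with hx | hx
    · have a := far1 x h0 hx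
      have b := up x hx
      rw [abs_sub_comm, abs_of_nonneg b]
      exact a.trans le3
    · have a := far1 (2 * L - x) (by linarith) (by linarith)
      have b := up (2 * L - x) (by linarith)
      have c : K (2 * L - x) = 2 * K L - K x := hG.prim_reflect x
      have d : K x - m / 2 = m / 2 - K (2 * L - x) := by rw [c]; linarith
      rw [d, abs_of_nonneg b]
      exact a.trans le3

theorem integral_add_mul_exp_le {δ ε : ℝ} (hδ : 0 < δ) (hε : 0 ≤ ε) :
    ∫ x in (0 : ℝ)..ε, (δ + x) * Real.exp (-(x / (4 * δ))) ≤ 20 * δ ^ 2 := by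
  have hd : ∀ x ∈ uIcc 0 ε, HasDerivAt (fun x => -(4 * δ * (5 * δ + x) * Real.exp (-(x / (4 * δ)))))
      ((δ + x) * Real.exp (-(x / (4 * δ)))) x := by
    intro x _
    have h1 : HasDerivAt (fun x : ℝ => -(x / (4 * δ))) (-(1 / (4 * δ))) x :=
      ((hasDerivAt_id x).div_const _).neg
    have := ((((hasDerivAt_id x).const_add (5 * δ)).const_mul (4 * δ)).mul h1.exp).neg
    refine this.congr_deriv ?_
    simp only [id]
    field_simp
    ring
  rw [intervalIntegral.integral_eq_sub_of_hasDerivAt hd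
    (Continuous.intervalIntegrable (by fun_prop) _ _)]
  have : 0 ≤ 4 * δ * (5 * δ + ε) * Real.exp (-(ε / (4 * δ))) := by positivity
  simp
  nlinarith

theorem IsBell.integral_sq_avg {L : ℝ} {G : ℝ → ℝ} (hL : 2 < L) (hG : IsBell L G) :
    ∫ x in (-L)..L, avg G x ^ 2
      = 2 * ∫ x in (0 : ℝ)..L, (prim G (x + 1 / 2) - prim G (x - 1 / 2)) ^ 2 := by
  have hW := hG.bell_avg hL
  have hi : ∀ a b, IntervalIntegrable (fun x => avg G x ^ 2) volume a b := fun a b =>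
    (hW.cont.pow 2).intervalIntegrable a b
  have h1 := intervalIntegral.integral_comp_neg (a := -L) (b := 0) (fun x => avg G x ^ 2)
  simp only [hW.even, neg_zero, neg_neg] at h1
  rw [← intervalIntegral.integral_add_adjacent_intervals (hi (-L) 0) (hi 0 L), h1]
  simp only [hG.avg_eq]
  ring

/-- Removing the tails from `∫ V²`: up to errors proportional to a bound `e` for the deviation of
`K` from `m/2` away from the origin, `∫ V² = m² - 4 ∫₀^{1/2} ((m/2)² - K²)`. -/
theorem IsBell.abs_integral_sq_avg_sub_le {L : ℝ} {G : ℝ → ℝ} (hL : 2 < L) (hG : IsBell L G)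
    {m e : ℝ} (hm : m = 2 * prim G L) (he : e ≤ m)
    (h : ∀ x, 1 / 2 ≤ x → x ≤ L + 1 / 2 → |prim G x - m / 2| ≤ e) :
    |(∫ x in (-L)..L, avg G x ^ 2)
      - (m ^ 2 - 4 * ∫ x in (0 : ℝ)..(1 / 2), ((m / 2) ^ 2 - prim G x ^ 2))| ≤ 10 * L * m * e := by
  rw [hG.integral_sq_avg hL]
  set K := prim G with hK
  have cK : Continuous K := hG.continuous_prim
  have e0 : 0 ≤ e := (abs_nonneg _).trans (h 1 (by norm_num) (by linarith))
  have m0 : 0 ≤ m := e0.trans he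
  have up : ∀ x, x ≤ L → K x ≤ m / 2 := fun x hx => by
    linarith [hG.monotone_prim hx]
  have lo : ∀ x, -(1 / 2) ≤ x → -(m / 2) ≤ K x := fun x hx => by
    have := hG.monotone_prim (by linarith : -L ≤ x)
    rw [hG.prim_neg] at this
    linarith
  -- replace `K (x + 1/2)` by `m / 2`
  have s1 : |(∫ x in (0 : ℝ)..L, (K (x + 1 / 2) - K (x - 1 / 2)) ^ 2)
      - ∫ x in (0 : ℝ)..L, (m / 2 - K (x - 1 / 2)) ^ 2| ≤ 4 * m * e * L := by
    rw [← intervalIntegral.integral_sub (Continuous.intervalIntegrable (by fun_prop) _ _)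
      (Continuous.intervalIntegrable (by fun_prop) _ _)]
    have := intervalIntegral.norm_integral_le_of_norm_le_const (a := 0) (b := L)
      (C := 4 * m * e) (f := fun x => (K (x + 1 / 2) - K (x - 1 / 2)) ^ 2
        - (m / 2 - K (x - 1 / 2)) ^ 2) fun x hx => ?_
    · rwa [sub_zero, abs_of_pos (by linarith : 0 < L)] at this
    rw [uIoc_of_le (by linarith)] at hx
    have a1 := h (x + 1 / 2) (by linarith [hx.1]) (by linarith [hx.2])
    have a2 := up (x - 1 / 2) (by linarith [hx.2])
    have a3 := lo (x - 1 / 2) (by linarith [hx.1])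
    have a4 := abs_le.1 a1
    rw [sq_sub_sq, Real.norm_eq_abs, abs_mul]
    have a5 : |K (x + 1 / 2) - K (x - 1 / 2) + (m / 2 - K (x - 1 / 2))| ≤ 4 * m :=
      abs_le.2 ⟨by linarith [a4.1], by linarith [a4.2]⟩
    have a6 : |K (x + 1 / 2) - K (x - 1 / 2) - (m / 2 - K (x - 1 / 2))| ≤ e := by
      rwa [show K (x + 1 / 2) - K (x - 1 / 2) - (m / 2 - K (x - 1 / 2)) = K (x + 1 / 2) - m / 2
        by ring]
    exact mul_le_mul a5 a6 (abs_nonneg _) (by linarith)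
  have s2 : ∫ x in (0 : ℝ)..L, (m / 2 - K (x - 1 / 2)) ^ 2
      = (m ^ 2 / 2 - 2 * ∫ x in (0 : ℝ)..(1 / 2), ((m / 2) ^ 2 - K x ^ 2))
        + ∫ x in (1 / 2 : ℝ)..(L - 1 / 2), (m / 2 - K x) ^ 2 := by
    have hi : ∀ a b, IntervalIntegrable (fun x => (m / 2 - K x) ^ 2) volume a b := fun a b =>
      Continuous.intervalIntegrable (by fun_prop) a b
    rw [intervalIntegral.integral_comp_sub_right (fun x => (m / 2 - K x) ^ 2), zero_sub,
      ← intervalIntegral.integral_add_adjacent_intervals (hi _ 0) (hi 0 _),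
      ← intervalIntegral.integral_add_adjacent_intervals (hi 0 (1 / 2)) (hi (1 / 2) _),
      ← add_assoc]
    congr 1
    have h1 := intervalIntegral.integral_comp_neg (a := 0) (b := 1 / 2)
      (fun x => (m / 2 - K x) ^ 2)
    rw [neg_zero] at h1
    rw [← h1, ← intervalIntegral.integral_const_mul, ← intervalIntegral.integral_add
      (Continuous.intervalIntegrable (by fun_prop) _ _) (hi _ _)]
    have h2 : m ^ 2 / 2 = ∫ x in (0 : ℝ)..(1 / 2), m ^ 2 := by
      rw [intervalIntegral.integral_const, smul_eq_mul]; ring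
    rw [h2, ← intervalIntegral.integral_sub (by simp)
      (Continuous.intervalIntegrable (by fun_prop) _ _)]
    congr 1; ext x
    rw [show K (-x) = -K x from hG.prim_neg x]
    ring
  have s3 : 0 ≤ ∫ x in (1 / 2 : ℝ)..(L - 1 / 2), (m / 2 - K x) ^ 2 :=
    intervalIntegral.integral_nonneg (by linarith) fun x _ => sq_nonneg _
  have s4 : ∫ x in (1 / 2 : ℝ)..(L - 1 / 2), (m / 2 - K x) ^ 2 ≤ L * (m * e) := by
    have : ∫ x in (1 / 2 : ℝ)..(L - 1 / 2), (m / 2 - K x) ^ 2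
        ≤ ∫ _ in (1 / 2 : ℝ)..(L - 1 / 2), m * e := by
      refine intervalIntegral.integral_mono_on (by linarith)
        (Continuous.intervalIntegrable (by fun_prop) _ _) (by simp) fun x hx => ?_
      have a := h x hx.1 (by linarith [hx.2])
      rw [abs_sub_comm] at a
      rw [← sq_abs, sq]
      exact mul_le_mul (a.trans he) a (abs_nonneg _) m0
    rw [intervalIntegral.integral_const, smul_eq_mul] at this
    have h2 : 0 ≤ m * e := by positivity
    nlinarith
  have s5 := abs_le.1 s1
  rw [s2] at s5
  rw [abs_le]
  constructor <;> nlinarith [s5.1, s5.2]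

/-- The normalization `‖V‖₂ = 1` fixes the mass up to second order. -/
theorem IsForce.exists_mass_approx {Ψ : ℝ → ℝ} {μ L : ℝ} (hΨ : IsForce Ψ μ) (hL : 2 < L)
    {C ε : ℝ} (hC : 0 < C) (hε : 0 < ε) (hε8 : ε ≤ 1 / 8) :
    ∃ C' δ₀ : ℝ, 0 < C' ∧ 0 < δ₀ ∧ ∀ {δ σ : ℝ} {R : ℝ → ℝ}, IsWave Ψ L δ σ R →
      IsSmall Ψ δ σ R → δ < δ₀ →
      IsProfile C ε L δ (mass Ψ L δ σ R) (density Ψ δ σ R) (prim (density Ψ δ σ R)) →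
      |mass Ψ L δ σ R - 1 - δ| ≤ C' * δ ^ 2 := by
  set M := 2 + 8 * L with hM
  have M0 : 0 < M := by positivity
  refine ⟨10 * L * M * C + 4 * (M * C + C * M ^ 2 * 20) + 4 * C + 1, min 1 (1 / (2 * C)),
    by positivity, by positivity, fun {δ σ R} hw hs hδ0 hp => ?_⟩
  have hδ := hw.delta_pos
  have hG := hw.bell_density hΨ
  have mlo := hw.half_le_mass hΨ hL
  have mhi := hw.mass_le hΨ hL
  have hδ2 := hs.delta_le
  have l1 : δ < 1 / (2 * C) := hδ0.trans_le (min_le_right _ _)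
  rw [lt_div_iff₀ (by positivity)] at l1
  have norm := hw.norm
  have mdef : mass Ψ L δ σ R = 2 * prim (density Ψ δ σ R) L := rfl
  set G := density Ψ δ σ R
  set m := mass Ψ L δ σ R
  have e1 : C * δ ^ 2 ≤ m := by nlinarith
  have key := hG.abs_integral_sq_avg_sub_le hL mdef e1
    fun x h0 h1 => hp.far x (by linarith) (by linarith)
  rw [norm] at key
  set K := prim G
  have cK : Continuous K := hG.continuous_prim
  have m0 : 0 < m := by linarith
  have up : ∀ x, x ≤ L → K x ≤ m / 2 := fun x hx => by
    linarith [hG.monotone_prim hx]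
  have q0 : ∀ x, 0 ≤ x → x ≤ L → 0 ≤ (m / 2) ^ 2 - K x ^ 2 := fun x h0 h1 => by
    have := up x h1
    have := hG.prim_nonneg h0
    nlinarith
  have q1 : ∀ x, 0 ≤ x → x ≤ L → (m / 2) ^ 2 - K x ^ 2 ≤ m * (m / 2 - K x) := fun x h0 h1 => by
    have := up x h1
    have := hG.prim_nonneg h0
    nlinarith
  have hi : ∀ a b, IntervalIntegrable (fun x => (m / 2) ^ 2 - K x ^ 2) volume a b := fun a b =>
    Continuous.intervalIntegrable (by fun_prop) a b
  have cG := hG.cont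
  -- the contribution of `[0, ε]`
  have t1 : |δ * K ε - ∫ x in (0 : ℝ)..ε, ((m / 2) ^ 2 - K x ^ 2)| ≤ C * M ^ 2 * (20 * δ ^ 2) := by
    have : K ε = ∫ x in (0 : ℝ)..ε, G x := rfl
    rw [this, ← intervalIntegral.integral_const_mul, ← intervalIntegral.integral_sub
      (Continuous.intervalIntegrable (by fun_prop) _ _) (hi _ _)]
    have b : ∀ x ∈ Ioc (0 : ℝ) ε, ‖δ * G x - ((m / 2) ^ 2 - K x ^ 2)‖
        ≤ C * M ^ 2 * ((δ + x) * Real.exp (-(x / (4 * δ)))) := by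
      intro x hx
      have x0 := hx.1
      refine (hp.logistic x hx.1.le hx.2).trans ?_
      have c1 := q1 x hx.1.le (by linarith [hx.2])
      have c2 := (hp.decay x hx.1.le hx.2).2
      have hE := Real.exp_pos (-(x / (4 * δ)))
      calc C * (δ + x) * ((m / 2) ^ 2 - K x ^ 2)
          ≤ C * (δ + x) * (M * (M * Real.exp (-(x / (4 * δ))))) := by
            gcongr
            refine c1.trans (mul_le_mul mhi (c2.trans ?_) ?_ M0.le)
            · gcongr
            · exact (hp.decay x hx.1.le hx.2).1
        _ = _ := by ring
    refine (intervalIntegral.norm_integral_le_of_norm_le hε.le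
      (Filter.Eventually.of_forall b) (Continuous.intervalIntegrable (by fun_prop) _ _)).trans ?_
    rw [intervalIntegral.integral_const_mul]
    gcongr
    exact integral_add_mul_exp_le hδ hε.le
  -- the contribution of `[ε, 1/2]`
  have t2 : 0 ≤ ∫ x in ε..(1 / 2), ((m / 2) ^ 2 - K x ^ 2) :=
    intervalIntegral.integral_nonneg (by linarith) fun x hx =>
      q0 x (by linarith [hx.1]) (by linarith [hx.2])
  have t3 : ∫ x in ε..(1 / 2), ((m / 2) ^ 2 - K x ^ 2) ≤ M * C * δ ^ 2 := by
    have : ∫ x in ε..(1 / 2), ((m / 2) ^ 2 - K x ^ 2) ≤ ∫ _ in ε..(1 / 2), M * (C * δ ^ 2) := by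
      refine intervalIntegral.integral_mono_on (by linarith) (hi _ _) (by simp) fun x hx => ?_
      refine (q1 x (by linarith [hx.1]) (by linarith [hx.2])).trans
        (mul_le_mul mhi ?_ (sub_nonneg.2 (up x (by linarith [hx.2]))) M0.le)
      have := (abs_le.1 (hp.far x hx.1 (by linarith [hx.2]))).1
      linarith
    rw [intervalIntegral.integral_const, smul_eq_mul] at this
    have h2 : 0 ≤ M * (C * δ ^ 2) := by positivity
    nlinarith
  rw [← intervalIntegral.integral_add_adjacent_intervals (hi 0 ε) (hi ε (1 / 2))] at key
  have t4 := abs_le.1 t1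
  have t5 := abs_le.1 key
  have t6 := abs_le.1 (hp.far ε le_rfl (by linarith))
  have t7 : 10 * L * m * (C * δ ^ 2) ≤ 10 * L * M * (C * δ ^ 2) := by gcongr
  have d2 : 0 ≤ δ ^ 2 := sq_nonneg δ
  have t8 : |δ * K ε - δ * (m / 2)| ≤ C * δ ^ 2 := by
    rw [← mul_sub, abs_mul, abs_of_pos hδ]
    calc δ * |K ε - m / 2| ≤ 1 * (C * δ ^ 2) := by
          gcongr
          · linarith
          · exact abs_le.2 t6
      _ = _ := one_mul _
  have t9 := abs_le.1 t8
  -- `m² = 1 + 2 δ m + O(δ²)` is a perfect square up to `δ²`.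
  have sq : |(m - δ) ^ 2 - 1|
      ≤ (10 * L * M * C + 4 * (M * C + C * M ^ 2 * 20) + 4 * C + 1) * δ ^ 2 := by
    rw [abs_le]
    constructor <;> nlinarith [t4.1, t4.2, t5.1, t5.2, t9.1, t9.2]
  have fac : (m - δ) ^ 2 - 1 = (m - 1 - δ) * (m - δ + 1) := by ring
  rw [fac, abs_mul] at sq
  refine le_trans (le_mul_of_one_le_right (abs_nonneg _) ?_) sq
  rw [abs_of_pos (by linarith)]
  linarith

/-! ### Comparison with the explicit profiles -/

/-- The explicit approximation of the primitive of the density. -/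
noncomputable def kink (δ x : ℝ) : ℝ := (1 + δ) * (Real.sigmoid (x / δ) - 1 / 2)

theorem kink_neg (δ x : ℝ) : kink δ (-x) = -kink δ x := by
  rw [kink, kink, neg_div, Real.sigmoid_neg]; ring

theorem continuous_kink (δ : ℝ) : Continuous (kink δ) :=
  continuous_const.mul ((continuous_sigmoid.comp (continuous_id.div_const δ)).sub
    continuous_const)

theorem approxV_eq (δ x : ℝ) : approxV δ x = kink δ (x + 1 / 2) - kink δ (x - 1 / 2) := by
  have e1 : (x + 1 / 2) / δ = x / δ + 1 / (2 * δ) := by ring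
  have e2 : (x - 1 / 2) / δ = x / δ - 1 / (2 * δ) := by ring
  rw [approxV, kink, kink, e1, e2, Real.sigmoid_def, Real.sigmoid_def, Real.sinh_eq, Real.cosh_eq,
    Real.cosh_eq, neg_add, neg_sub, Real.exp_add, Real.exp_sub, Real.exp_neg, Real.exp_neg]
  have hY := Real.exp_pos (x / δ)
  have hP := Real.exp_pos (1 / (2 * δ))
  generalize Real.exp (x / δ) = Y at *
  generalize Real.exp (1 / (2 * δ)) = P at *
  field_simp
  ring

theorem hasDerivAt_log_cosh {δ : ℝ} (hδ : 0 < δ) (x : ℝ) :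
    HasDerivAt (fun x => (1 + δ) * δ * Real.log (Real.cosh (x / (2 * δ)))) (kink δ x) x := by
  have h0 : HasDerivAt (fun x : ℝ => x / (2 * δ)) (1 / (2 * δ)) x := (hasDerivAt_id x).div_const _
  have := ((h0.cosh).log (Real.cosh_pos _).ne').const_mul ((1 + δ) * δ)
  refine this.congr_deriv ?_
  have e : x / δ = x / (2 * δ) + x / (2 * δ) := by field_simp; ring
  rw [kink, e, Real.sigmoid_def, neg_add, Real.exp_add, Real.exp_neg, Real.sinh_eq, Real.cosh_eq,
    Real.exp_neg]
  have hY := Real.exp_pos (x / (2 * δ))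
  generalize Real.exp (x / (2 * δ)) = Y at *
  field_simp
  ring

theorem approxR_eq_avg {δ : ℝ} (hδ : 0 < δ) (x : ℝ) : approxR δ x = avg (approxV δ) x := by
  have hd : ∀ t ∈ uIcc (x - 1 / 2) (x + 1 / 2), HasDerivAt
      (fun t => (1 + δ) * δ * Real.log (Real.cosh ((t + 1 / 2) / (2 * δ)))
        - (1 + δ) * δ * Real.log (Real.cosh ((t - 1 / 2) / (2 * δ)))) (approxV δ t) t := by
    intro t _
    rw [approxV_eq]
    exact ((hasDerivAt_log_cosh hδ (t + 1 / 2)).comp_add_const t (1 / 2)).sub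
      ((hasDerivAt_log_cosh hδ (t - 1 / 2)).comp_sub_const t (1 / 2))
  have hc : Continuous (approxV δ) := by
    rw [funext (approxV_eq δ)]
    have := continuous_kink δ
    fun_prop
  rw [avg, intervalIntegral.integral_eq_sub_of_hasDerivAt hd (hc.intervalIntegrable _ _)]
  have e1 : (x + 1 / 2 + 1 / 2) / (2 * δ) = x / (2 * δ) + 1 / (2 * δ) := by ring
  have e2 : (x + 1 / 2 - 1 / 2) / (2 * δ) = x / (2 * δ) := by ring
  have e3 : (x - 1 / 2 + 1 / 2) / (2 * δ) = x / (2 * δ) := by ring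
  have e4 : (x - 1 / 2 - 1 / 2) / (2 * δ) = x / (2 * δ) - 1 / (2 * δ) := by ring
  rw [e1, e2, e3, e4, approxR]
  set a := x / (2 * δ)
  set b := 1 / (2 * δ)
  have p0 := Real.cosh_pos a
  have p1 := Real.cosh_pos (a + b)
  have p2 := Real.cosh_pos (a - b)
  have e5 : 1 + Real.sinh b ^ 2 / Real.cosh a ^ 2
      = Real.cosh (a + b) * Real.cosh (a - b) / Real.cosh a ^ 2 := by
    rw [eq_div_iff (by positivity), add_mul, div_mul_cancel₀ _ (by positivity), Real.cosh_add,
      Real.cosh_sub]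
    have h1 := Real.cosh_sq a
    have h2 := Real.cosh_sq b
    linear_combination -(Real.cosh a ^ 2) * h2 - Real.sinh b ^ 2 * h1
  rw [e5, Real.log_div (by positivity) (by positivity), Real.log_mul p1.ne' p2.ne', Real.log_pow]
  push_cast
  ring

theorem add_sq_mul_exp_le {y : ℝ} (hy : 0 ≤ y) :
    (y + y ^ 2) * Real.exp (-(y / 4)) ≤ 136 * Real.exp (-(y / 8)) := by
  have h1 := Real.quadratic_le_exp_of_nonneg (by positivity : 0 ≤ y / 8)
  have h2 : y + y ^ 2 ≤ 136 * Real.exp (y / 8) := by nlinarith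
  calc (y + y ^ 2) * Real.exp (-(y / 4)) ≤ 136 * Real.exp (y / 8) * Real.exp (-(y / 4)) := by
        gcongr
    _ = 136 * Real.exp (-(y / 8)) := by
        rw [mul_assoc, ← Real.exp_add]; congr 2; ring

theorem abs_sigmoid_sub_half_le (y : ℝ) : |Real.sigmoid y - 1 / 2| ≤ 1 / 2 := by
  have a := Real.sigmoid_pos y
  have b := Real.sigmoid_lt_one y
  rw [abs_le]; constructor <;> linarith

theorem IsProfile.near_kink {C C' ε L δ m M : ℝ} {G K : ℝ → ℝ} (hp : IsProfile C ε L δ m G K)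
    (hC : 0 < C) (hC' : 0 < C') (hδ : 0 < δ) (hδ2 : δ ≤ 1 / 2) (mlo : 1 / 2 ≤ m) (mhi : m ≤ M)
    (hm : |m - 1 - δ| ≤ C' * δ ^ 2) {x : ℝ} (h0 : 0 ≤ x) (h1 : x ≤ ε) :
    |K x - kink δ x| ≤ M * ((M * C + 1 + C') * 136) * (δ * Real.exp (-(x / (8 * δ))))
      + C' * δ ^ 2 := by
  have M0 : 0 < M := by linarith
  have sig := abs_sigmoid_sub_half_le (x / δ)
  obtain ⟨u, hu1, hu2, hu3⟩ := hp.phase x h0 h1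
  set y := x / δ with hy
  have xy : x = δ * y := by rw [hy]; field_simp
  have y0 : 0 ≤ y := by positivity
  have b1 : |u - y| ≤ (M * C + 1 + C') * (δ * (y + y ^ 2)) := by
    have c1 : m * x / δ = m * y := by rw [hy]; ring
    have c2 : x + x ^ 2 / δ = δ * (y + y ^ 2) := by rw [xy]; field_simp
    rw [c1, c2] at hu3
    have c3 : |m - 1| ≤ (1 + C') * δ := by
      have := abs_add_le (m - 1 - δ) δ
      rw [sub_add_cancel, abs_of_pos hδ] at this
      have : C' * δ ^ 2 ≤ C' * δ := by
        gcongr; nlinarith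
      linarith
    have c4 : |u - y| ≤ |u - m * y| + |m - 1| * y := by
      have := abs_add_le (u - m * y) ((m - 1) * y)
      rwa [show u - m * y + (m - 1) * y = u - y by ring, abs_mul, abs_of_nonneg y0] at this
    calc |u - y| ≤ m * C * (δ * (y + y ^ 2)) + (1 + C') * δ * y := c4.trans (by gcongr)
      _ ≤ M * C * (δ * (y + y ^ 2)) + (1 + C') * (δ * (y + y ^ 2)) := by
          rw [mul_assoc (1 + C')]
          gcongr
          nlinarith
      _ = _ := by ring
  have b2 : y / 4 ≤ u := by
    refine le_trans ?_ hu2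
    have : m * x / (2 * δ) = m * y / 2 := by rw [hy]; field_simp
    rw [this]
    nlinarith
  have b3 := abs_sigmoid_sub_le b2 (by linarith : y / 4 ≤ y)
  have b4 : K x - kink δ x
      = m * (Real.sigmoid u - Real.sigmoid y) + (m - 1 - δ) * (Real.sigmoid y - 1 / 2) := by
    rw [hu1, kink]; ring
  have b5 : |m * (Real.sigmoid u - Real.sigmoid y)|
      ≤ M * ((M * C + 1 + C') * 136) * (δ * Real.exp (-(x / (8 * δ)))) := by
    rw [abs_mul, abs_of_pos (by linarith : 0 < m)]
    have ey : x / (8 * δ) = y / 8 := by rw [hy]; field_simp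
    have c5 := add_sq_mul_exp_le y0
    calc m * |Real.sigmoid u - Real.sigmoid y|
        ≤ M * (Real.exp (-(y / 4)) * ((M * C + 1 + C') * (δ * (y + y ^ 2)))) := by
          gcongr
          exact b3.trans (by gcongr)
      _ = M * (M * C + 1 + C') * δ * ((y + y ^ 2) * Real.exp (-(y / 4))) := by ring
      _ ≤ M * (M * C + 1 + C') * δ * (136 * Real.exp (-(y / 8))) := by gcongr
      _ = _ := by rw [ey]; ring
  have b6 : |(m - 1 - δ) * (Real.sigmoid y - 1 / 2)| ≤ C' * δ ^ 2 := by
    rw [abs_mul]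
    calc |m - 1 - δ| * |Real.sigmoid y - 1 / 2| ≤ C' * δ ^ 2 * 1 := by
          gcongr; linarith
      _ = _ := mul_one _
  rw [b4]
  exact (abs_add_le _ _).trans (add_le_add b5 b6)

theorem IsProfile.far_kink {C C' ε L δ m : ℝ} {G K : ℝ → ℝ} (hp : IsProfile C ε L δ m G K)
    (hδ : 0 < δ) (hδ2 : δ ≤ 1 / 2)
    (hm : |m - 1 - δ| ≤ C' * δ ^ 2) {x : ℝ} (h1 : ε ≤ x) (hx : x ≤ 2 * L - ε) :
    |K x - kink δ x| ≤ (C + C') * δ ^ 2 + 2 * Real.exp (-(ε / δ)) := by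
  have a1 := hp.far x h1 hx
  have a2 := one_sub_sigmoid_le (x / δ)
  have a3 : Real.exp (-(x / δ)) ≤ Real.exp (-(ε / δ)) := by gcongr
  have a4 : K x - kink δ x = (K x - m / 2) + ((m - 1 - δ) / 2
      + (1 + δ) * (1 - Real.sigmoid (x / δ))) := by rw [kink]; ring
  have a5 := Real.sigmoid_lt_one (x / δ)
  have a6 : |(m - 1 - δ) / 2| ≤ C' * δ ^ 2 := by
    rw [abs_div, abs_two]
    linarith [abs_nonneg (m - 1 - δ)]
  have a7 : |(1 + δ) * (1 - Real.sigmoid (x / δ))| ≤ 2 * Real.exp (-(ε / δ)) := by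
    rw [abs_of_nonneg (mul_nonneg (by linarith) (by linarith))]
    exact mul_le_mul (by linarith) (a2.trans a3) (by linarith) (by norm_num)
  rw [a4]
  have b1 := abs_add_le (K x - m / 2) ((m - 1 - δ) / 2 + (1 + δ) * (1 - Real.sigmoid (x / δ)))
  have b2 := abs_add_le ((m - 1 - δ) / 2) ((1 + δ) * (1 - Real.sigmoid (x / δ)))
  linarith

/-- The primitive of the density is uniformly close to the explicit kink: to first order in `δ`
with exponential decay on the scale `δ`, and to second order away from the origin. -/
theorem IsForce.exists_abs_prim_sub_kink_le {Ψ : ℝ → ℝ} {μ L : ℝ} (hΨ : IsForce Ψ μ) (hL : 2 < L) :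
    ∃ C δ₀ : ℝ, 0 < C ∧ 0 < δ₀ ∧ ∀ {δ σ : ℝ} {R : ℝ → ℝ}, IsWave Ψ L δ σ R → δ < δ₀ →
      ∀ x, |x| ≤ L + 1 → |prim (density Ψ δ σ R) x - kink δ x|
        ≤ C * (δ ^ 2 + δ * Real.exp (-(|x| / (8 * δ)))) := by
  obtain ⟨C, ε, hC, hε, hε8, h⟩ := hΨ.exists_isProfile hL
  obtain ⟨C', δ₁, hC', hδ₁, h'⟩ := hΨ.exists_mass_approx hL hC hε hε8
  obtain ⟨δ₂, hδ₂, h₂⟩ := hΨ.exists_isSmall (Ψ := Ψ)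
  obtain ⟨F, hF, hexp⟩ : ∃ F : ℝ, 0 ≤ F ∧ ∀ δ, 0 < δ → Real.exp (-(ε / δ)) ≤ F * δ ^ 2 :=
    ⟨_, by positivity, fun δ hδ => exp_neg_div_le hε hδ 2⟩
  obtain ⟨B, hB⟩ : ∃ B, B = (2 + 8 * L) * (((2 + 8 * L) * C + 1 + C') * 136) := ⟨_, rfl⟩
  have B0 : 0 ≤ B := by rw [hB]; positivity
  refine ⟨B + C' + C + 2 * F, min (min δ₁ δ₂) ε, by positivity, by positivity,
    fun {δ σ R} hw hlt x hx => ?_⟩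
  obtain ⟨⟨l1, l2⟩, l3⟩ := by simpa only [lt_min_iff] using hlt
  have hs := h₂ hw l2
  have hp := h hw hs l3.le
  have hm := h' hw hs l1 hp
  have hδ := hw.delta_pos
  have hG := hw.bell_density hΨ
  have mlo := hw.half_le_mass hΨ hL
  have mhi := hw.mass_le hΨ hL
  wlog h0 : 0 ≤ x generalizing x
  · have := this (-x) (by rwa [abs_neg]) (by linarith)
    rwa [hG.prim_neg, kink_neg, abs_neg, neg_sub_neg, abs_sub_comm] at this
  rw [abs_of_nonneg h0] at hx ⊢
  have d2 : 0 ≤ δ ^ 2 := sq_nonneg δ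
  have dE : 0 ≤ δ * Real.exp (-(x / (8 * δ))) := by positivity
  obtain ⟨E, hE⟩ : ∃ E, E = δ * Real.exp (-(x / (8 * δ))) := ⟨_, rfl⟩
  rw [← hE] at dE ⊢
  have n1 : B * E ≤ (B + C' + C + 2 * F) * E := mul_le_mul_of_nonneg_right (by linarith) dE
  have n2 : 0 ≤ (B + C' + C + 2 * F) * E := (mul_nonneg B0 dE).trans n1
  have n3 : (C + C' + 2 * F) * δ ^ 2 ≤ (B + C' + C + 2 * F) * δ ^ 2 :=
    mul_le_mul_of_nonneg_right (by linarith) d2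
  have n4 : C' * δ ^ 2 ≤ (C + C' + 2 * F) * δ ^ 2 :=
    mul_le_mul_of_nonneg_right (by linarith) d2
  rw [mul_add]
  rcases le_total x ε with h1 | h1
  · have := hp.near_kink hC hC' hδ hs.delta_le mlo mhi hm h0 h1
    rw [← hB, ← hE] at this
    linarith
  · have := hp.far_kink hδ hs.delta_le hm h1 (by linarith)
    have := hexp δ hδ
    linarith

/-! ### Estimates in Lebesgue norms -/

theorem integral_exp_neg_abs_sub_le {a b c s : ℝ} (hs : 0 < s) (hac : a ≤ c) (hcb : c ≤ b) :
    ∫ x in a..b, Real.exp (-(|x - c| / s)) ≤ 2 * s := by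
  have hi : ∀ a b, IntervalIntegrable (fun x => Real.exp (-(|x - c| / s))) volume a b := fun a b =>
    Continuous.intervalIntegrable (by fun_prop) a b
  rw [← intervalIntegral.integral_add_adjacent_intervals (hi a c) (hi c b)]
  have h1 : ∫ x in a..c, Real.exp (-(|x - c| / s)) = s * 1 - s * Real.exp ((a - c) / s) := by
    have e : ∫ x in a..c, Real.exp (-(|x - c| / s)) = ∫ x in a..c, Real.exp ((x - c) / s) := by
      refine intervalIntegral.integral_congr fun x hx => ?_
      rw [uIcc_of_le hac] at hx
      simp only [abs_of_nonpos (by linarith [hx.2] : x - c ≤ 0), neg_div, neg_neg]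
    have hd : ∀ x ∈ uIcc a c, HasDerivAt (fun x => s * Real.exp ((x - c) / s))
        (Real.exp ((x - c) / s)) x := fun x _ => by
      have := ((((hasDerivAt_id x).sub_const c).div_const s).exp).const_mul s
      refine this.congr_deriv ?_
      simp only [id]
      field_simp
    rw [e, intervalIntegral.integral_eq_sub_of_hasDerivAt hd
      (Continuous.intervalIntegrable (by fun_prop) _ _)]
    simp
  have h2 : ∫ x in c..b, Real.exp (-(|x - c| / s)) = s * 1 - s * Real.exp (-((b - c) / s)) := by
    have e : ∫ x in c..b, Real.exp (-(|x - c| / s)) = ∫ x in c..b, Real.exp (-((x - c) / s)) := by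
      refine intervalIntegral.integral_congr fun x hx => ?_
      rw [uIcc_of_le hcb] at hx
      simp only [abs_of_nonneg (by linarith [hx.1] : 0 ≤ x - c)]
    have hd : ∀ x ∈ uIcc c b, HasDerivAt (fun x => -(s * Real.exp (-((x - c) / s))))
        (Real.exp (-((x - c) / s))) x := fun x _ => by
      have := (((((hasDerivAt_id x).sub_const c).div_const s).neg.exp).const_mul s).neg
      refine this.congr_deriv ?_
      simp only [id, Pi.neg_apply]
      field_simp
    rw [e, intervalIntegral.integral_eq_sub_of_hasDerivAt hd
      (Continuous.intervalIntegrable (by fun_prop) _ _)]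
    simp
    ring
  rw [h1, h2]
  have p1 := Real.exp_pos ((a - c) / s)
  have p2 := Real.exp_pos (-((b - c) / s))
  nlinarith

theorem continuous_approxV (δ : ℝ) : Continuous (approxV δ) := by
  rw [funext (approxV_eq δ)]
  have := continuous_kink δ
  fun_prop

/-- Uniform and `L¹` estimates for the velocity profile on the cell enlarged by `1/2`. -/
theorem IsForce.exists_velocity_bounds {Ψ : ℝ → ℝ} {μ L : ℝ} (hΨ : IsForce Ψ μ) (hL : 2 < L) :
    ∃ C δ₀ : ℝ, 0 < C ∧ 0 < δ₀ ∧ ∀ {δ σ : ℝ} {R : ℝ → ℝ}, IsWave Ψ L δ σ R → δ < δ₀ →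
      (∀ x, |x| ≤ L + 1 / 2 → |avg (density Ψ δ σ R) x - approxV δ x| ≤ C * δ) ∧
      ∫ x in (-(L + 1 / 2))..(L + 1 / 2), |avg (density Ψ δ σ R) x - approxV δ x| ≤ C * δ ^ 2 := by
  obtain ⟨C, δ₀, hC, hδ₀, h⟩ := hΨ.exists_abs_prim_sub_kink_le hL
  refine ⟨2 * C * (2 * L + 1) + 32 * C, min δ₀ 1, by positivity, by positivity,
    fun {δ σ R} hw hlt => ?_⟩
  have hδ := hw.delta_pos
  have l1 : δ < δ₀ := hlt.trans_le (min_le_left _ _)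
  have l2 : δ < 1 := hlt.trans_le (min_le_right _ _)
  have hG := hw.bell_density hΨ
  have hW := hG.bell_avg hL
  have key : ∀ x, |x| ≤ L + 1 / 2 → |avg (density Ψ δ σ R) x - approxV δ x|
      ≤ 2 * C * δ ^ 2 + C * δ * (Real.exp (-(|x - -(1 / 2)| / (8 * δ)))
        + Real.exp (-(|x - 1 / 2| / (8 * δ)))) := by
    intro x hx
    have hx' := abs_le.1 hx
    have a1 := h hw l1 (x + 1 / 2) (abs_le.2 ⟨by linarith [hx'.1], by linarith [hx'.2]⟩)
    have a2 := h hw l1 (x - 1 / 2) (abs_le.2 ⟨by linarith [hx'.1], by linarith [hx'.2]⟩)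
    rw [hG.avg_eq, approxV_eq, sub_neg_eq_add]
    have := abs_sub (prim (density Ψ δ σ R) (x + 1 / 2) - kink δ (x + 1 / 2))
      (prim (density Ψ δ σ R) (x - 1 / 2) - kink δ (x - 1 / 2))
    rw [sub_sub_sub_comm] at this
    linarith
  constructor
  · intro x hx
    refine (key x hx).trans ?_
    have e1 : Real.exp (-(|x - -(1 / 2)| / (8 * δ))) ≤ 1 :=
      Real.exp_le_one_iff.2 (neg_nonpos.2 (by positivity))
    have e2 : Real.exp (-(|x - 1 / 2| / (8 * δ))) ≤ 1 :=
      Real.exp_le_one_iff.2 (neg_nonpos.2 (by positivity))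
    calc _ ≤ 2 * C * (δ * 1) + C * δ * (1 + 1) := by
          rw [sq]; gcongr
      _ ≤ (2 * C * (2 * L + 1) + 32 * C) * δ := by
          have : 0 < C * δ := by positivity
          nlinarith
  · have cV := continuous_approxV δ
    have cA := hW.cont
    have i1 : ∀ c : ℝ, IntervalIntegrable (fun x => Real.exp (-(|x - c| / (8 * δ)))) volume
        (-(L + 1 / 2)) (L + 1 / 2) := fun c => Continuous.intervalIntegrable (by fun_prop) _ _
    have := intervalIntegral.integral_mono_on (a := -(L + 1 / 2)) (b := L + 1 / 2) (by linarith)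
      (Continuous.intervalIntegrable (by fun_prop) _ _)
      ((intervalIntegrable_const (c := 2 * C * δ ^ 2)).add
        (((i1 (-(1 / 2))).add (i1 (1 / 2))).const_mul (C * δ)))
      fun x hx => key x (abs_le.2 hx)
    refine this.trans ?_
    rw [intervalIntegral.integral_add intervalIntegrable_const
      (((i1 (-(1 / 2))).add (i1 (1 / 2))).const_mul (C * δ)),
      intervalIntegral.integral_const_mul (C * δ),
      intervalIntegral.integral_add (i1 _) (i1 _), intervalIntegral.integral_const, smul_eq_mul]
    have b1 := integral_exp_neg_abs_sub_le (a := -(L + 1 / 2)) (b := L + 1 / 2) (c := -(1 / 2))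
      (by positivity : 0 < 8 * δ) (by linarith) (by linarith)
    have b2 := integral_exp_neg_abs_sub_le (a := -(L + 1 / 2)) (b := L + 1 / 2) (c := 1 / 2)
      (by positivity : 0 < 8 * δ) (by linarith) (by linarith)
    calc _ ≤ (L + 1 / 2 - -(L + 1 / 2)) * (2 * C * δ ^ 2)
          + C * δ * (2 * (8 * δ) + 2 * (8 * δ)) := by gcongr
      _ = _ := by ring

/-- Interpolation between a uniform bound of order `δ` and an `L¹` bound of order `δ²`. -/
theorem eLpNorm_le_of_uniform_of_integral {L C δ : ℝ} (hL : 0 < L) (hC : 0 < C) (hδ : 0 < δ)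
    {h : ℝ → ℝ} (hc : Continuous h) (h1 : ∀ x, |x| ≤ L → |h x| ≤ C * δ)
    (h2 : ∫ x in (-L)..L, |h x| ≤ C * δ ^ 2) {p : ℝ≥0∞} (hp : 1 ≤ p) :
    eLpNorm h p (cell L) ≤ ENNReal.ofReal (C * δ ^ (1 + (p⁻¹).toReal)) := by
  have hae : ∀ᵐ x ∂cell L, |h x| ≤ C * δ :=
    (ae_restrict_iff' measurableSet_Icc).2
      (Filter.Eventually.of_forall fun x hx => h1 x (abs_le.2 hx))
  rcases eq_or_ne p ∞ with rfl | hpt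
  · rw [eLpNorm_exponent_top]
    simp only [ENNReal.inv_top, ENNReal.toReal_zero, add_zero, Real.rpow_one]
    refine eLpNormEssSup_le_of_ae_bound (hae.mono fun x hx => by rwa [Real.norm_eq_abs])
  · have hp0 : p ≠ 0 := (zero_lt_one.trans_le hp).ne'
    have hq : 1 ≤ p.toReal := by
      rw [← ENNReal.toReal_one]; exact ENNReal.toReal_mono hpt hp
    set q := p.toReal with hqdef
    have q0 : 0 < q := by linarith
    rw [eLpNorm_eq_lintegral_rpow_enorm_toReal hp0 hpt, ENNReal.toReal_inv, ← hqdef]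
    have hint : ∫⁻ x, ‖h x‖ₑ ∂cell L ≤ ENNReal.ofReal (C * δ ^ 2) := by
      have : Integrable h (cell L) := memLp_one_iff_integrable.1 (memLp_cell_of_continuous hc 1)
      rw [← ofReal_integral_norm_eq_lintegral_enorm this]
      refine ENNReal.ofReal_le_ofReal (le_trans (le_of_eq ?_) h2)
      exact integral_cell hL fun x => |h x|
    have hpow : ∫⁻ x, ‖h x‖ₑ ^ q ∂cell L
        ≤ ENNReal.ofReal (C * δ) ^ (q - 1) * ENNReal.ofReal (C * δ ^ 2) := by
      calc ∫⁻ x, ‖h x‖ₑ ^ q ∂cell L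
          ≤ ∫⁻ x, ENNReal.ofReal (C * δ) ^ (q - 1) * ‖h x‖ₑ ∂cell L := by
            refine lintegral_mono_ae (hae.mono fun x hx => ?_)
            have : ‖h x‖ₑ ^ q = ‖h x‖ₑ ^ (q - 1) * ‖h x‖ₑ := by
              conv_lhs => rw [show q = q - 1 + 1 by ring]
              rw [ENNReal.rpow_add_of_nonneg _ _ (by linarith) zero_le_one, ENNReal.rpow_one]
            rw [this]
            gcongr
            rw [← ofReal_norm, Real.norm_eq_abs]
            exact ENNReal.ofReal_le_ofReal hx
        _ ≤ _ := by
            rw [lintegral_const_mul' _ _ (ENNReal.rpow_ne_top_of_nonneg (by linarith)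
              ENNReal.ofReal_ne_top)]
            gcongr
    calc (∫⁻ x, ‖h x‖ₑ ^ q ∂cell L) ^ (1 / q)
        ≤ (ENNReal.ofReal (C * δ) ^ (q - 1) * ENNReal.ofReal (C * δ ^ 2)) ^ (1 / q) := by gcongr
      _ = ENNReal.ofReal (C * δ ^ (1 + q⁻¹)) := by
          rw [ENNReal.ofReal_rpow_of_pos (by positivity), ← ENNReal.ofReal_mul (by positivity),
            ENNReal.ofReal_rpow_of_pos (by positivity)]
          congr 1
          have e1 : (C * δ) ^ (q - 1) * (C * δ ^ 2) = (C * δ ^ (1 + q⁻¹)) ^ q := by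
            rw [Real.mul_rpow hC.le (by positivity), Real.mul_rpow hC.le (by positivity),
              ← Real.rpow_mul hδ.le, add_mul, one_mul, inv_mul_cancel₀ q0.ne']
            have e2 : C ^ q = C ^ (q - 1) * C := by
              conv_lhs => rw [show q = q - 1 + 1 by ring]
              rw [Real.rpow_add hC, Real.rpow_one]
            have e3 : δ ^ (q + 1) = δ ^ (q - 1) * δ ^ 2 := by
              rw [show q + 1 = q - 1 + 2 by ring, Real.rpow_add hδ, Real.rpow_two]
            rw [e2, e3]; ring
          rw [e1, one_div, Real.rpow_rpow_inv (by positivity) q0.ne']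

theorem eLpNorm_cell_le_of_bound {L B : ℝ} (hL : 2 < L) {h : ℝ → ℝ}
    (h1 : ∀ x, |x| ≤ L → |h x| ≤ B) {p : ℝ≥0∞} (hp : 1 ≤ p) :
    eLpNorm h p (cell L) ≤ ENNReal.ofReal (2 * L * B) := by
  have hae : ∀ᵐ x ∂cell L, ‖h x‖ ≤ B :=
    (ae_restrict_iff' measurableSet_Icc).2
      (Filter.Eventually.of_forall fun x hx => h1 x (abs_le.2 hx))
  refine (eLpNorm_le_of_ae_bound hae).trans ?_
  have hu : cell L univ = ENNReal.ofReal (2 * L) := by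
    rw [cell, Measure.restrict_apply_univ, Real.volume_Icc]; congr 1; ring
  rw [hu, ENNReal.ofReal_mul (by linarith : 0 ≤ 2 * L)]
  gcongr
  have h2 : (1 : ℝ≥0∞) ≤ ENNReal.ofReal (2 * L) := by
    rw [ENNReal.one_le_ofReal]; linarith
  have h3 : p.toReal⁻¹ ≤ 1 := by
    rcases eq_or_ne p ∞ with rfl | hpt
    · simp
    · refine inv_le_one_of_one_le₀ ?_
      rw [← ENNReal.toReal_one]; exact ENNReal.toReal_mono hpt hp
  calc ENNReal.ofReal (2 * L) ^ p.toReal⁻¹ ≤ ENNReal.ofReal (2 * L) ^ (1 : ℝ) :=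
        ENNReal.rpow_le_rpow_of_exponent_le h2 h3
    _ = _ := ENNReal.rpow_one _

end FPU

theorem theorem2p4 (L : ℝ) (hL : 2 < L) (Ψ : ℝ → ℝ) (μ : ℝ) (hΨ : FPU.IsForce Ψ μ) :
    ∃ C δ₀ : ℝ, 0 < C ∧ 0 < δ₀ ∧
      ∀ Φ : ℝ → ℝ, FPU.IsPotential Φ Ψ →
      ∀ δ : ℝ, 0 < δ → δ < δ₀ →
      ∀ V : ℝ → ℝ, FPU.IsMaximizer Φ L δ V →
      ∀ p : ℝ≥0∞, 1 ≤ p →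
        eLpNorm (fun x => V x - FPU.approxV δ x) p (FPU.cell L)
            ≤ ENNReal.ofReal (C * δ ^ (1 + (p⁻¹).toReal)) ∧
        eLpNorm (fun x => FPU.avg V x - FPU.approxR δ x) p (FPU.cell L)
            ≤ ENNReal.ofReal (C * δ ^ 2) := by
  obtain ⟨δ₁, hδ₁, h₁⟩ := hΨ.exists_isWave hL
  obtain ⟨C, δ₂, hC, hδ₂, h₂⟩ := hΨ.exists_velocity_bounds hL
  refine ⟨2 * L * C, min δ₁ δ₂, by positivity, by positivity,
    fun Φ hΦ δ hδ hlt V hV p hp => ?_⟩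
  obtain ⟨σ, hw, hae⟩ := h₁ Φ hΦ δ hδ (hlt.trans_le (min_le_left _ _)) V hV
  obtain ⟨hsup, hint⟩ := h₂ hw (hlt.trans_le (min_le_right _ _))
  have hW := (hw.bell_density hΨ).bell_avg hL
  set W := FPU.avg (FPU.density Ψ δ σ (FPU.avg V)) with hWdef
  have hc : Continuous fun x => W x - FPU.approxV δ x := hW.cont.sub (FPU.continuous_approxV δ)
  have hint' : ∀ a b, -(L + 1 / 2) ≤ a → a ≤ b → b ≤ L + 1 / 2 →
      ∫ x in a..b, |W x - FPU.approxV δ x| ≤ C * δ ^ 2 := fun a b ha hab hb =>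
    (intervalIntegral.integral_mono_interval ha hab hb
      (Filter.Eventually.of_forall fun x => abs_nonneg _)
      (hc.abs.intervalIntegrable _ _)).trans hint
  constructor
  · have e : (fun x => V x - FPU.approxV δ x) =ᵐ[FPU.cell L] fun x => W x - FPU.approxV δ x :=
      (ae_restrict_of_ae hae).mono fun x hx => by simp only [hx]
    rw [eLpNorm_congr_ae e]
    refine (FPU.eLpNorm_le_of_uniform_of_integral (by linarith) hC hδ hc
      (fun x hx => hsup x (by linarith)) (hint' _ _ (by linarith) (by linarith) (by linarith))
      hp).trans (ENNReal.ofReal_le_ofReal ?_)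
    gcongr
    nlinarith
  · rw [mul_assoc]
    refine FPU.eLpNorm_cell_le_of_bound hL (fun x hx => ?_) hp
    have hx' := abs_le.1 hx
    have e : FPU.avg V x - FPU.approxR δ x
        = ∫ t in (x - 1 / 2)..(x + 1 / 2), (W t - FPU.approxV δ t) := by
      rw [FPU.approxR_eq_avg hδ, FPU.avg_congr_ae hae, FPU.avg, FPU.avg,
        intervalIntegral.integral_sub (hW.cont.intervalIntegrable _ _)
          ((FPU.continuous_approxV δ).intervalIntegrable _ _)]
    rw [e]
    exact (intervalIntegral.abs_integral_le_integral_abs (by linarith)).trans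
      (hint' _ _ (by linarith [hx'.1]) (by linarith) (by linarith [hx'.2]))
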